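/- **Setting.** Let $G(z)$ ($p\times m$) and $H(z)$ ($p\times r$) be rational transfer matrices, all of whose poles lie in the open unit disk $\mathbb D$, with $H$ proper and $G$ of relative degree at least $1$, and let $G_u(z)$ ($m\times p$) and $H_u(z)$ ($m\times s$) be proper rational transfer matrices. Let $\{e_t\}_{t\ge 0}$ and $\{\epsilon_t\}_{t\ge0}$ be mutually independent processes, each i.i.d. with zero mean, unit covariance ($\mathbb E\, e_te_t^H=I$, $\mathbb E\,\epsilon_t\epsilon_t^H=I$) and finite fourth moments. The signals $y_t\in\mathbb C^p$ and $u_t\in\mathbb C^m$, $t\ge 0$, satisfy, with zero initial conditions, $$y_t=G(z)u_t+H(z)e_t,\qquad u_t=G_u(z)y_t+H_u(z)\epsilon_t,$$ where $z$ is the time-shift operator ($zu_t=u_{t+1}$), and this feedback loop is stable: the closed-loop transfer matrices from $(e,\epsilon)$ to $(y,u)$ have all their poles in $\mathbb D$. (Matrices and signals may be complex; the real case is included.) For a process $X_t$ write $\bar{\mathbb E}(X_t)=\lim_{t\to\infty}\mathbb E(X_t)$. A signal $w_t$ is *persistently exciting of order $n$* if the limit covariance matrix $\bar{\mathbb E}(W_tW_t^H)$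 of the stacked vectors $W_t=(w_t,\dots,w_{t+n-1})$ exists and is positive definite. Assume that the probing component $H_u(z)\epsilon_t$ is persistently exciting of sufficiently high order, that is, of an order $n_0$ depending only on $G$, $G_u$ and $q$. Let $\mu_1,\dots,\mu_q\in\mathbb D$ be distinct. For matrices $R_1,\dots,R_q\in\mathbb C^{p\times m}$ consider the model $\sum_{k=1}^q \frac{R_k}{z-\mu_k}$. Let $(\check R_1(N),\dots,\check R_q(N))$ be a minimizer of $$\frac1N\sum_{t=1}^N\Big\|y_t-\sum_{k=1}^q\frac{R_k}{z-\mu_k}u_t\Big\|^2,$$ let $(\check R_1^*,\dots,\check R_q^*)$ be a minimizer of $\bar{\mathbb E}\big\|y_t-\sum_{k=1}^q\frac{R_k}{z-\mu_k}u_t\big\|^2$, and put $\check G_N(z)=\sum_k \check R_k(N)/(z-\mu_k)$ and $\check G^*(z)=\sum_k\check R_k^*/(z-\mu_k)$. The $\mathcal H_2$ norm is $\|F\|_2=\big(\frac1{2\pi}\int_0^{2\pi}\mathrm{tr}\,[F(e^{i\theta})F(e^{i\theta})^H]\,d\theta\big)^{1/2}$. **Theorem (Almost sure convergence).** The limit $\bar{\mathbb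 E}\|\cdot\|^2$ above exists for all $R_1,\dots,R_q$ and has a unique minimizer $(\check R^*_k)$; almost surely, the $N$-sample least-squares problem has a unique solution for all sufficiently large $N$; and almost surely, for every $\varepsilon>0$, $$\lim_{N\to\infty}\frac{\|\check G_N(z)-\check G^*(z)\|_2}{N^{-1/2+\varepsilon}}=0 .$$ -/

import Mathlib

open Filter Topology MeasureTheory ProbabilityTheory
open scoped ComplexConjugate ComplexOrder

noncomputable section

namespace OBF

/-! ### Transfer functions -/

/-- The Laurent expansion of a rational function `f(z)` at `z = ∞`, as a Laurent series in
`w = z⁻¹`: the variable `z` is replaced by `w⁻¹`. -/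
def laurentAtInfty (f : RatFunc ℂ) : LaurentSeries ℂ :=
  f.eval (HahnSeries.C : ℂ →+* LaurentSeries ℂ) (HahnSeries.single (-1) 1)

/-- The impulse response (Markov parameters) of `f`: the coefficient of `z^{-j}` in the expansion
of `f` at infinity, so that `f(z) = ∑_{j ≥ 0} impulse f j * z^{-j}` for proper `f`. -/
def impulse (f : RatFunc ℂ) (j : ℕ) : ℂ := (laurentAtInfty f).coeff (j : ℤ)

/-- A transfer matrix is proper (causal): no entry has a numerator of degree larger than that of
its denominator. -/
def IsProper {a b : ℕ} (F : Matrix (Fin a) (Fin b) (RatFunc ℂ)) : Prop :=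
  ∀ i j, (F i j).num.degree ≤ (F i j).denom.degree

/-- Relative degree at least one (the zero entry is allowed). -/
def IsStrictlyProper {a b : ℕ} (F : Matrix (Fin a) (Fin b) (RatFunc ℂ)) : Prop :=
  ∀ i j, (F i j).num.degree < (F i j).denom.degree

/-- Strict stability: all poles lie in the open unit disk. -/
def IsStable {a b : ℕ} (F : Matrix (Fin a) (Fin b) (RatFunc ℂ)) : Prop :=
  ∀ i j (z : ℂ), (F i j).denom.IsRoot z → ‖z‖ < 1

/-- The signal `F(z) x_t`, where `z` is the time shift and the signal `x_0, x_1, …` starts at time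
`0` (zero initial conditions): `∑_{j=0}^{t} F_j x_{t-j}` with `F_j` the Markov parameters. -/
def applyTF {a b : ℕ} (F : Matrix (Fin a) (Fin b) (RatFunc ℂ)) (x : ℕ → Fin b → ℂ) (t : ℕ) :
    Fin a → ℂ :=
  fun i => ∑ j ∈ Finset.range (t + 1), ∑ k, impulse (F i k) j * x (t - j) k

/-- The `H₂` norm `((2π)⁻¹ ∫_0^{2π} tr (F(e^{iθ}) F(e^{iθ})ᴴ) dθ)^{1/2}`. -/
def h2Norm {a b : ℕ} (F : Matrix (Fin a) (Fin b) (RatFunc ℂ)) : ℝ :=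
  Real.sqrt ((2 * Real.pi)⁻¹ * ∫ θ in (0 : ℝ)..(2 * Real.pi),
    ∑ i, ∑ j, ‖(F i j).eval (RingHom.id ℂ) (Complex.exp (θ * Complex.I))‖ ^ 2)

/-- Stability of the feedback interconnection `y = G u + H e`, `u = Gᵤ y + Hᵤ ε`: the four closed
loop transfer matrices from `e` and `ε` to `y` and `u` are strictly stable. Here
`(1 - G Gᵤ)⁻¹` is the sensitivity function. -/
def IsClosedLoopStable {p m r s : ℕ}
    (G : Matrix (Fin p) (Fin m) (RatFunc ℂ)) (H : Matrix (Fin p) (Fin r) (RatFunc ℂ))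
    (Gu : Matrix (Fin m) (Fin p) (RatFunc ℂ)) (Hu : Matrix (Fin m) (Fin s) (RatFunc ℂ)) : Prop :=
  IsStable ((1 - G * Gu)⁻¹ * H) ∧
  IsStable ((1 - G * Gu)⁻¹ * G * Hu) ∧
  IsStable (Gu * (1 - G * Gu)⁻¹ * H) ∧
  IsStable (Hu + Gu * (1 - G * Gu)⁻¹ * G * Hu)

/-- The model `∑ₖ Rₖ / (z - μₖ)`. -/
def model {p m q : ℕ} (μ : Fin q → ℂ) (R : Fin q → Matrix (Fin p) (Fin m) ℂ) :
    Matrix (Fin p) (Fin m) (RatFunc ℂ) :=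
  ∑ k, (1 / (RatFunc.X - RatFunc.C (μ k)) : RatFunc ℂ) • (R k).map RatFunc.C

/-! ### Stochastic processes -/

variable {Ω : Type*} [MeasurableSpace Ω]

/-- The limit expected value `lim_{t → ∞} E (X_t)` exists and is equal to `L`. -/
def HasLimitExpectation {E : Type*} [NormedAddCommGroup E] [NormedSpace ℝ E]
    (P : Measure Ω) (X : ℕ → Ω → E) (L : E) : Prop :=
  (∀ t, Integrable (X t) P) ∧ Tendsto (fun t => ∫ ω, X t ω ∂P) atTop (𝓝 L)

/-- An i.i.d. vector process with zero mean, unit covariance and finite fourth moments. -/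
structure IsIIDNoise {d : ℕ} (P : Measure Ω) (e : ℕ → Ω → Fin d → ℂ) : Prop where
  measurable : ∀ t, Measurable (e t)
  indep : iIndepFun e P
  identDistrib : ∀ t, IdentDistrib (e t) (e 0) P P
  fourthMoment : ∀ t i, MemLp (fun ω => e t ω i) 4 P
  mean_zero : ∀ t i, ∫ ω, e t ω i ∂P = 0
  unit_cov : ∀ t i j, ∫ ω, e t ω i * conj (e t ω j) ∂P = if i = j then 1 else 0

/-- A signal `w` is persistently exciting of order `n` if the limit covariance matrix of the
stacked vectors `(w_t, …, w_{t+n-1})` (the block Toeplitz matrix of the autocovariances of `w`)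
exists and is positive definite. -/
def IsPersistentlyExciting {m : ℕ} (P : Measure Ω) (w : ℕ → Ω → Fin m → ℂ) (n : ℕ) : Prop :=
  ∃ C : Matrix (Fin n × Fin m) (Fin n × Fin m) ℂ, C.PosDef ∧
    ∀ i j, HasLimitExpectation P
      (fun t ω => w (t + (i.1 : ℕ)) ω i.2 * conj (w (t + (j.1 : ℕ)) ω j.2)) (C i j)

/-! ### Least squares -/

/-- The squared prediction error `‖y_t - ∑ₖ Rₖ / (z - μₖ) u_t‖²` in the Euclidean norm. -/
def sqError {p m q : ℕ} (μ : Fin q → ℂ) (y : ℕ → Fin p → ℂ) (u : ℕ → Fin m → ℂ)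
    (R : Fin q → Matrix (Fin p) (Fin m) ℂ) (t : ℕ) : ℝ :=
  ∑ i, ‖y t i - applyTF (model μ R) u t i‖ ^ 2

/-- The least-squares cost for the samples at times `1, …, N`. -/
def lsCost {p m q : ℕ} (μ : Fin q → ℂ) (y : ℕ → Fin p → ℂ) (u : ℕ → Fin m → ℂ) (N : ℕ)
    (R : Fin q → Matrix (Fin p) (Fin m) ℂ) : ℝ :=
  (1 / (N : ℝ)) * ∑ t ∈ Finset.Icc 1 N, sqError μ y u R t

/-- `R` is a solution of the least-squares problem with `N` samples. -/
def IsLSSolution {p m q : ℕ} (μ : Fin q → ℂ) (y : ℕ → Fin p → ℂ) (u : ℕ → Fin m → ℂ) (N : ℕ)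
    (R : Fin q → Matrix (Fin p) (Fin m) ℂ) : Prop :=
  ∀ R' : Fin q → Matrix (Fin p) (Fin m) ℂ, lsCost μ y u N R ≤ lsCost μ y u N R'

end OBF

end

/-! ### Algebra of the feedback loop and decay of its impulse responses. -/

noncomputable section

namespace OBF

open scoped Matrix

/-! ### Expansion at infinity as a ring homomorphism -/

/-! Expanding at infinity turns signals and transfer functions into Laurent series in z⁻¹, so that
filtering becomes multiplication in a field. Since G has no term at infinity, 1 - G Gᵤ is invertible
over the power series in z⁻¹. The loop can therefore be solved: y and the regressors u/(z - μₖ) are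
outputs of causal filters driven by the joint white noise (e, ε) (`closed_loop`, `eq_filtered`).
Closed-loop stability makes their impulse responses decay exponentially (`expDecay_impulse`).

The cost is a quadratic function of the coefficients. Its data are time averages of products of two
such outputs, which expand into products of noise values at two lags. For a fixed pair of lags the
centred products at different times are orthogonal with bounded second moments
(`IsWhite.lagProd_orthogonal`), and the weights of the pairs are absolutely summable. Hence sums
over n consecutive times have second moment O(n). A dyadic maximal inequality of Rademacher–Menshov
type then gives almost sure convergence of the averages with error o(N^(-1/2+δ)) for every δ > 0
(`IsWhite.ae_hasRate_filtered`).

If the limit Gram matrix Γ is positive definite, this rate passes through the normal equations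
(`hasRate_normal_equations`) and from the coefficients to the H₂ norm (`exists_h2Norm_le`).

Positive definiteness comes from excitation. A null vector of Γ makes a combination of the regressor
filters vanish; their ε-part reads V T Hᵤ = 0, where V is a row of sums cₖ/(z - μₖ) and T = (1 - Gᵤ
G)⁻¹. Clearing the denominators of V T yields a polynomial row that annihilates the probing signal,
of degree bounded in terms of G, Gᵤ and q. Persistent excitation forces it to be zero; then V = 0
because T is invertible, and c = 0 because the poles are distinct (`exists_excitation_order`). -/

/-- Substitution of `w⁻¹` for the variable of a polynomial, as a Laurent series in `w`. -/
def polyLaurent : Polynomial ℂ →+* LaurentSeries ℂ :=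
  Polynomial.eval₂RingHom (HahnSeries.C : ℂ →+* LaurentSeries ℂ) (HahnSeries.single (-1) 1)

lemma polyLaurent_apply (P : Polynomial ℂ) :
    polyLaurent P = ∑ n ∈ P.support, HahnSeries.single (-(n : ℤ)) (P.coeff n) := by
  rw [polyLaurent, Polynomial.coe_eval₂RingHom, Polynomial.eval₂_eq_sum, Polynomial.sum_def]
  refine Finset.sum_congr rfl fun n _ => ?_
  rw [HahnSeries.single_pow, HahnSeries.C_apply, HahnSeries.single_mul_single]
  simp

lemma coeff_polyLaurent_neg (P : Polynomial ℂ) (n : ℕ) :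
    (polyLaurent P).coeff (-(n : ℤ)) = P.coeff n := by
  rw [polyLaurent_apply, HahnSeries.coeff_sum, Finset.sum_eq_single n]
  · simp
  · intro k _ hk
    rw [HahnSeries.coeff_single_of_ne]
    intro h
    exact hk (by omega)
  · intro h
    simpa using h

lemma coeff_polyLaurent_pos (P : Polynomial ℂ) (n : ℤ) (hn : 0 < n) :
    (polyLaurent P).coeff n = 0 := by
  rw [polyLaurent_apply, HahnSeries.coeff_sum]
  refine Finset.sum_eq_zero fun k _ => ?_
  rw [HahnSeries.coeff_single_of_ne]
  omega

lemma polyLaurent_injective : Function.Injective polyLaurent := by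
  intro P Q h
  ext n
  rw [← coeff_polyLaurent_neg, h, coeff_polyLaurent_neg]

lemma order_polyLaurent {P : Polynomial ℂ} (hP : P ≠ 0) :
    (polyLaurent P).order = -(P.natDegree : ℤ) := by
  have h0 : polyLaurent P ≠ 0 := by
    rw [Ne, map_eq_zero_iff _ polyLaurent_injective]; exact hP
  refine le_antisymm (HahnSeries.order_le_of_coeff_ne_zero ?_) ?_
  · rw [coeff_polyLaurent_neg]
    simpa using hP
  · rw [HahnSeries.le_order_iff_forall h0]
    intro j hj
    obtain ⟨k, rfl⟩ : ∃ k : ℕ, j = -(k : ℤ) := ⟨j.natAbs, by omega⟩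
    rw [coeff_polyLaurent_neg]
    exact Polynomial.coeff_eq_zero_of_natDegree_lt (by omega)

/-- The expansion at infinity, as a ring homomorphism. -/
def laurentHom : RatFunc ℂ →+* LaurentSeries ℂ :=
  RatFunc.liftRingHom polyLaurent (nonZeroDivisors_le_comap_nonZeroDivisors_of_injective _
    polyLaurent_injective)

lemma laurentAtInfty_eq (f : RatFunc ℂ) : laurentAtInfty f = laurentHom f := by
  rw [laurentHom, RatFunc.liftRingHom_apply]
  -- `RatFunc.eval` is itself the quotient of the two substituted polynomials.
  rfl

lemma laurentHom_injective : Function.Injective laurentHom := laurentHom.injective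

lemma laurentHom_algebraMap (P : Polynomial ℂ) :
    laurentHom (algebraMap _ _ P) = polyLaurent P :=
  RatFunc.liftRingHom_algebraMap _ _ _

lemma laurentHom_C (a : ℂ) : laurentHom (RatFunc.C a) = HahnSeries.C a := by
  rw [← RatFunc.algebraMap_C, laurentHom_algebraMap]
  simp [polyLaurent]

lemma laurentHom_denom_mul (f : RatFunc ℂ) :
    polyLaurent f.denom * laurentHom f = polyLaurent f.num := by
  rw [← laurentHom_algebraMap, ← laurentHom_algebraMap, ← map_mul, mul_comm]
  congr 1
  have := RatFunc.num_div_denom f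
  rw [div_eq_iff (by simpa using f.denom_ne_zero)] at this
  exact this.symm

lemma impulse_eq (f : RatFunc ℂ) (j : ℕ) : impulse f j = (laurentHom f).coeff (j : ℤ) := by
  rw [impulse, laurentAtInfty_eq]

/-! ### Signals as power series -/

/-- The generating series of a signal, inside the field of Laurent series. -/
def sig (x : ℕ → ℂ) : LaurentSeries ℂ := HahnSeries.ofPowerSeries ℤ ℂ (PowerSeries.mk x)

lemma coeff_sig (x : ℕ → ℂ) (n : ℕ) : (sig x).coeff (n : ℤ) = x n := by
  rw [sig, HahnSeries.ofPowerSeries_apply_coeff, PowerSeries.coeff_mk]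

/-- Identities between signals may thus be proved in a field, where transfer functions can be
divided. -/
lemma sig_injective : Function.Injective sig := by
  intro x y h
  ext n
  rw [← coeff_sig x, h, coeff_sig]

lemma sig_add (x y : ℕ → ℂ) : sig (fun t => x t + y t) = sig x + sig y := by
  rw [sig, sig, sig, ← map_add]
  rfl

lemma sig_sum {κ : Type*} (s : Finset κ) (x : κ → ℕ → ℂ) :
    sig (fun t => ∑ k ∈ s, x k t) = ∑ k ∈ s, sig (x k) := by
  simp only [sig]
  rw [← map_sum]
  congr 1
  ext n
  simp

/-- The convolution of two sequences has the product as its generating series. -/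
lemma sig_conv (x y : ℕ → ℂ) :
    sig (fun t => ∑ j ∈ Finset.range (t + 1), x j * y (t - j)) = sig x * sig y := by
  rw [sig, sig, sig, ← map_mul]
  congr 1
  ext n
  rw [PowerSeries.coeff_mul, Finset.Nat.sum_antidiagonal_eq_sum_range_succ_mk]
  simp

/-- Laurent series without terms of negative degree. -/
def causal : Subring (LaurentSeries ℂ) := (HahnSeries.ofPowerSeries ℤ ℂ).range

lemma mem_causal_iff {x : LaurentSeries ℂ} : x ∈ causal ↔ ∀ n < 0, x.coeff n = 0 := by
  constructor
  · rintro ⟨f, rfl⟩ n hn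
    rw [HahnSeries.ofPowerSeries_apply]
    refine HahnSeries.embDomain_of_notMem_range ?_
    rintro ⟨k, hk⟩
    simp at hk
    omega
  · intro h
    refine ⟨PowerSeries.mk fun n => x.coeff n, ?_⟩
    ext n
    rcases lt_or_ge n 0 with hn | hn
    · rw [h n hn, HahnSeries.ofPowerSeries_apply]
      refine HahnSeries.embDomain_of_notMem_range ?_
      rintro ⟨k, hk⟩
      simp at hk
      omega
    · lift n to ℕ using hn
      rw [HahnSeries.ofPowerSeries_apply_coeff, PowerSeries.coeff_mk]

lemma sig_coeff_of_mem_causal {x : LaurentSeries ℂ} (hx : x ∈ causal) :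
    sig (fun n => x.coeff n) = x := by
  obtain ⟨f, rfl⟩ := hx
  rw [sig]
  congr 1
  ext n
  simp

/-- `impulse` forgets the coefficients of negative index; causality says that nothing is lost. -/
lemma sig_impulse {f : RatFunc ℂ} (hf : laurentHom f ∈ causal) :
    sig (impulse f) = laurentHom f := by
  rw [← sig_coeff_of_mem_causal hf]
  congr 1
  ext n
  rw [impulse_eq]

/-- The order at infinity is the relative degree, which turns degree conditions into vanishing of
coefficients. -/
lemma order_laurentHom {f : RatFunc ℂ} (hf : f ≠ 0) :
    (laurentHom f).order = (f.denom.natDegree : ℤ) - f.num.natDegree := by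
  have h := congrArg HahnSeries.order (laurentHom_denom_mul f)
  have h1 : polyLaurent f.denom ≠ 0 := by
    rw [Ne, map_eq_zero_iff _ polyLaurent_injective]; exact f.denom_ne_zero
  have h2 : laurentHom f ≠ 0 := by rwa [Ne, map_eq_zero]
  rw [HahnSeries.order_mul h1 h2, order_polyLaurent f.denom_ne_zero,
    order_polyLaurent (RatFunc.num_ne_zero hf)] at h
  omega

lemma laurentHom_mem_causal {f : RatFunc ℂ} (hf : f.num.degree ≤ f.denom.degree) :
    laurentHom f ∈ causal := by
  rcases eq_or_ne f 0 with rfl | h0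
  · simp
  rw [mem_causal_iff]
  intro n hn
  apply HahnSeries.coeff_eq_zero_of_lt_order
  rw [order_laurentHom h0]
  have := Polynomial.natDegree_le_natDegree hf
  omega

lemma coeff_zero_laurentHom {f : RatFunc ℂ} (hf : f.num.degree < f.denom.degree) :
    (laurentHom f).coeff 0 = 0 := by
  rcases eq_or_ne f 0 with rfl | h0
  · simp
  apply HahnSeries.coeff_eq_zero_of_lt_order
  rw [order_laurentHom h0]
  have := Polynomial.natDegree_lt_natDegree (RatFunc.num_ne_zero h0) hf
  omega

/-- All entries are power series in `z⁻¹`. -/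
def IsCausal {α β : Type*} (F : Matrix α β (RatFunc ℂ)) : Prop :=
  ∀ i j, laurentHom (F i j) ∈ causal

lemma IsProper.isCausal {a b : ℕ} {F : Matrix (Fin a) (Fin b) (RatFunc ℂ)} (hF : IsProper F) :
    IsCausal F := fun i j => laurentHom_mem_causal (hF i j)

lemma IsStrictlyProper.isCausal {a b : ℕ} {F : Matrix (Fin a) (Fin b) (RatFunc ℂ)}
    (hF : IsStrictlyProper F) : IsCausal F := fun i j => laurentHom_mem_causal (hF i j).le

lemma IsCausal.mul {α β γ : Type*} [Fintype β] {F : Matrix α β (RatFunc ℂ)}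
    {K : Matrix β γ (RatFunc ℂ)} (hF : IsCausal F) (hK : IsCausal K) : IsCausal (F * K) := by
  intro i j
  rw [Matrix.mul_apply, map_sum]
  refine causal.sum_mem fun k _ => ?_
  rw [map_mul]
  exact causal.mul_mem (hF i k) (hK k j)

lemma IsCausal.add {α β : Type*} {F K : Matrix α β (RatFunc ℂ)} (hF : IsCausal F)
    (hK : IsCausal K) : IsCausal (F + K) := by
  intro i j
  rw [Matrix.add_apply, map_add]
  exact causal.add_mem (hF i j) (hK i j)

/-- The generating series of a vector signal. -/
def sigv {β : Type*} (x : ℕ → β → ℂ) : β → LaurentSeries ℂ := fun k => sig fun t => x t k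

/-- `F(z)` acts on generating series by multiplication. -/
lemma sigv_applyTF {a b : ℕ} {F : Matrix (Fin a) (Fin b) (RatFunc ℂ)} (hF : IsCausal F)
    (x : ℕ → Fin b → ℂ) : sigv (applyTF F x) = F.map laurentHom *ᵥ sigv x := by
  ext1 i
  simp only [sigv, applyTF, Matrix.mulVec, dotProduct, Matrix.map_apply]
  have : ∀ k, laurentHom (F i k) * sig (fun t => x t k) =
      sig (fun t => ∑ j ∈ Finset.range (t + 1), impulse (F i k) j * x (t - j) k) := by
    intro k
    rw [sig_conv (impulse (F i k)) (fun t => x t k), sig_impulse (hF i k)]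
  simp only [this]
  rw [← sig_sum]
  congr 1
  ext t
  rw [Finset.sum_comm]

/-! ### The feedback loop -/

/-- Modulo z⁻¹ the matrix 1 - A is the identity, so its determinant is a unit of the power series
ring and it has an inverse over that ring. Inside Laurent series this inverse must agree with the
one over rational functions. -/
lemma isUnit_det_and_isCausal_inv {p : ℕ} {A : Matrix (Fin p) (Fin p) (RatFunc ℂ)}
    (hA : IsCausal A) (h0 : ∀ i j, (laurentHom (A i j)).coeff 0 = 0) :
    IsUnit (1 - A).det ∧ IsCausal (1 - A)⁻¹ := by
  set B : Matrix (Fin p) (Fin p) (PowerSeries ℂ) :=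
    Matrix.of fun i j => PowerSeries.mk (impulse (A i j)) with hB
  have hBA : B.map (HahnSeries.ofPowerSeries ℤ ℂ) = A.map laurentHom := by
    ext1 i j
    exact sig_impulse (hA i j)
  have hBA1 : (1 - B).map (HahnSeries.ofPowerSeries ℤ ℂ) = (1 - A).map laurentHom := by
    rw [Matrix.map_sub _ (map_sub _), Matrix.map_sub _ (map_sub _), hBA]
    simp
  have hB0 : (1 - B).map (PowerSeries.constantCoeff (R := ℂ)) = 1 := by
    ext1 i j
    have : PowerSeries.constantCoeff (B i j) = 0 := by
      rw [hB, Matrix.of_apply, ← PowerSeries.coeff_zero_eq_constantCoeff_apply,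
        PowerSeries.coeff_mk, impulse_eq]
      exact h0 i j
    rw [Matrix.map_apply, Matrix.sub_apply, map_sub, this, Matrix.one_apply, Matrix.one_apply]
    split_ifs <;> simp
  have hdet : IsUnit (1 - B).det := by
    rw [PowerSeries.isUnit_iff_constantCoeff, RingHom.map_det]
    have : (PowerSeries.constantCoeff (R := ℂ)).mapMatrix (1 - B) = 1 := hB0
    rw [this]
    simp
  have hdetA : laurentHom (1 - A).det = HahnSeries.ofPowerSeries ℤ ℂ (1 - B).det := by
    rw [RingHom.map_det, RingHom.map_det]
    exact congrArg Matrix.det hBA1.symm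
  have hu : IsUnit (1 - A).det := by
    rw [isUnit_iff_ne_zero]
    intro h
    rw [h, map_zero] at hdetA
    have := hdet.map (HahnSeries.ofPowerSeries ℤ ℂ)
    rw [← hdetA] at this
    exact not_isUnit_zero this
  refine ⟨hu, ?_⟩
  have h1 : (1 - A)⁻¹.map laurentHom = (1 - B)⁻¹.map (HahnSeries.ofPowerSeries ℤ ℂ) := by
    have e1 : (1 - A).map laurentHom * (1 - A)⁻¹.map laurentHom = 1 := by
      rw [← Matrix.map_mul, Matrix.mul_nonsing_inv _ hu]
      simp
    have e2 : (1 - B)⁻¹.map (HahnSeries.ofPowerSeries ℤ ℂ) * (1 - A).map laurentHom = 1 := by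
      rw [← hBA1, ← Matrix.map_mul, Matrix.nonsing_inv_mul _ hdet]
      simp
    exact (left_inv_eq_right_inv e2 e1).symm
  intro i j
  exact ⟨(1 - B)⁻¹ i j, (congrFun (congrFun h1 i) j).symm⟩

section Loop

variable {p m r s : ℕ} {G : Matrix (Fin p) (Fin m) (RatFunc ℂ)}
  {H : Matrix (Fin p) (Fin r) (RatFunc ℂ)} {Gu : Matrix (Fin m) (Fin p) (RatFunc ℂ)}
  {Hu : Matrix (Fin m) (Fin s) (RatFunc ℂ)}

/-- The loop is well posed because G delays by at least one step: G Gᵤ has no constant term even if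
Gᵤ has one. -/
lemma sensitivity (hG : IsStrictlyProper G) (hGu : IsProper Gu) :
    IsUnit (1 - G * Gu).det ∧ IsCausal (1 - G * Gu)⁻¹ := by
  refine isUnit_det_and_isCausal_inv (hG.isCausal.mul hGu.isCausal) fun i j => ?_
  rw [Matrix.mul_apply, map_sum, HahnSeries.coeff_sum]
  refine Finset.sum_eq_zero fun k _ => ?_
  rw [map_mul, ← sig_impulse (hG.isCausal i k), ← sig_impulse (hGu.isCausal k j), ← sig_conv]
  have := coeff_sig (fun t => ∑ l ∈ Finset.range (t + 1),
    impulse (G i k) l * impulse (Gu k j) (t - l)) 0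
  rw [Nat.cast_zero] at this
  rw [this]
  simp [impulse_eq, coeff_zero_laurentHom (hG i k)]

/-- Push-through identity. The left factor is what the loop inserts between the probing signal and
the input; excitation needs its invertibility. -/
lemma one_sub_mul_inv (hG : IsStrictlyProper G) (hGu : IsProper Gu) :
    (1 + Gu * (1 - G * Gu)⁻¹ * G) * (1 - Gu * G) = 1 := by
  have h : (1 - G * Gu)⁻¹ * (1 - G * Gu) = 1 :=
    Matrix.nonsing_inv_mul _ (sensitivity hG hGu).1
  calc _ = 1 - Gu * G + Gu * ((1 - G * Gu)⁻¹ * (1 - G * Gu)) * G := by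
        simp only [Matrix.mul_sub, Matrix.sub_mul, Matrix.add_mul, Matrix.mul_one, Matrix.one_mul,
          Matrix.mul_assoc]
        abel
    _ = 1 := by rw [h]; simp

/-- Closed loop expression of the signals in terms of the noises. -/
lemma closed_loop (hG : IsStrictlyProper G) (hGu : IsProper Gu) (hH : IsProper H)
    (hHu : IsProper Hu) {e : ℕ → Fin r → ℂ} {ε : ℕ → Fin s → ℂ} {y : ℕ → Fin p → ℂ}
    {u : ℕ → Fin m → ℂ}
    (hy : ∀ t, y t = applyTF G u t + applyTF H e t)
    (hu : ∀ t, u t = applyTF Gu y t + applyTF Hu ε t) :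
    (sigv y = ((1 - G * Gu)⁻¹ * H).map laurentHom *ᵥ sigv e +
      ((1 - G * Gu)⁻¹ * G * Hu).map laurentHom *ᵥ sigv ε) ∧
    (sigv u = (Gu * (1 - G * Gu)⁻¹ * H).map laurentHom *ᵥ sigv e +
      (Hu + Gu * (1 - G * Gu)⁻¹ * G * Hu).map laurentHom *ᵥ sigv ε) := by
  have hs := sensitivity hG hGu
  have hadd : ∀ {b : ℕ} (x x' : ℕ → Fin b → ℂ), sigv (fun t => x t + x' t) = sigv x + sigv x' := by
    intro b x x'
    ext1 k
    exact sig_add _ _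
  have hy' : sigv y = G.map laurentHom *ᵥ sigv u + H.map laurentHom *ᵥ sigv e := by
    rw [← sigv_applyTF hG.isCausal, ← sigv_applyTF hH.isCausal, ← hadd]
    exact congrArg sigv (funext hy)
  have hu' : sigv u = Gu.map laurentHom *ᵥ sigv y + Hu.map laurentHom *ᵥ sigv ε := by
    rw [← sigv_applyTF hGu.isCausal, ← sigv_applyTF hHu.isCausal, ← hadd]
    exact congrArg sigv (funext hu)
  have hinv : (1 - G * Gu)⁻¹.map laurentHom * (1 - G * Gu).map laurentHom = 1 := by
    rw [← Matrix.map_mul, Matrix.nonsing_inv_mul _ hs.1]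
    simp
  have hyS : sigv y = ((1 - G * Gu)⁻¹ * H).map laurentHom *ᵥ sigv e +
      ((1 - G * Gu)⁻¹ * G * Hu).map laurentHom *ᵥ sigv ε := by
    have h1 : (1 - G * Gu).map laurentHom *ᵥ sigv y =
        H.map laurentHom *ᵥ sigv e + (G * Hu).map laurentHom *ᵥ sigv ε := by
      have e1 : (1 - G * Gu).map laurentHom =
          1 - G.map laurentHom * Gu.map laurentHom := by
        rw [Matrix.map_sub _ (map_sub _), Matrix.map_mul]; simp
      rw [e1, Matrix.sub_mulVec, Matrix.one_mulVec, ← Matrix.mulVec_mulVec, Matrix.map_mul,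
        ← Matrix.mulVec_mulVec]
      have e2 : G.map laurentHom *ᵥ sigv u = G.map laurentHom *ᵥ (Gu.map laurentHom *ᵥ sigv y) +
          G.map laurentHom *ᵥ (Hu.map laurentHom *ᵥ sigv ε) := by
        rw [← Matrix.mulVec_add, ← hu']
      nth_rw 1 [hy']
      rw [e2]
      abel
    have h2 := congrArg (fun x => (1 - G * Gu)⁻¹.map laurentHom *ᵥ x) h1
    simp only [Matrix.mulVec_mulVec, hinv, Matrix.one_mulVec, Matrix.mulVec_add,
      ← Matrix.map_mul] at h2
    rw [h2, Matrix.mul_assoc]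
  refine ⟨hyS, ?_⟩
  rw [hu', hyS, Matrix.mulVec_add, Matrix.mulVec_mulVec, Matrix.mulVec_mulVec, ← Matrix.map_mul,
    ← Matrix.map_mul, Matrix.map_add _ (map_add _), Matrix.add_mulVec]
  simp only [Matrix.mul_assoc]
  abel

end Loop

/-! ### Exponential decay of impulse responses -/

/-- Exponential decay of a sequence. -/
def ExpDecay (x : ℕ → ℂ) : Prop := ∃ C ρ : ℝ, 0 ≤ C ∧ 0 < ρ ∧ ρ < 1 ∧ ∀ n, ‖x n‖ ≤ C * ρ ^ n

/-- A rate τ strictly above both ρ and ‖a‖ avoids the resonant case ρ = ‖a‖. The constant D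
satisfies ‖a‖ D + C ≤ τ D, which closes the induction. -/
lemma ExpDecay.of_recurrence {x y : ℕ → ℂ} {a : ℂ} (ha : ‖a‖ < 1) (hx : ExpDecay x)
    (h : ∀ n, y (n + 1) = a * y n + x n) : ExpDecay y := by
  obtain ⟨C, ρ, hC, hρ0, hρ1, hb⟩ := hx
  obtain ⟨τ, hτ, hτ1⟩ := exists_between (max_lt hρ1 ha)
  have hτρ : ρ < τ := (le_max_left _ _).trans_lt hτ
  have hτa : ‖a‖ < τ := (le_max_right _ _).trans_lt hτ
  have hτ0 : 0 < τ := hρ0.trans hτρ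
  have hd : 0 < τ - ‖a‖ := sub_pos.2 hτa
  refine ⟨max ‖y 0‖ (C / (τ - ‖a‖)), τ, le_max_of_le_left (norm_nonneg _), hτ0, hτ1, ?_⟩
  set D := max ‖y 0‖ (C / (τ - ‖a‖)) with hD
  have hCD : C ≤ D * (τ - ‖a‖) := (div_le_iff₀ hd).1 (le_max_right _ _)
  intro n
  induction n with
  | zero => simp [hD]
  | succ n ih =>
    rw [h]
    have h1 : ρ ^ n ≤ τ ^ n := pow_le_pow_left₀ hρ0.le hτρ.le n
    calc ‖a * y n + x n‖ ≤ ‖a‖ * ‖y n‖ + ‖x n‖ := by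
          simpa using norm_add_le (a * y n) (x n)
      _ ≤ ‖a‖ * (D * τ ^ n) + C * τ ^ n := by
          refine add_le_add (mul_le_mul_of_nonneg_left ih (norm_nonneg _)) ((hb n).trans ?_)
          exact mul_le_mul_of_nonneg_left h1 hC
      _ ≤ ‖a‖ * (D * τ ^ n) + D * (τ - ‖a‖) * τ ^ n := by
          gcongr
      _ = D * τ ^ (n + 1) := by ring

/-- The factor z - a acts as a first-order difference operator, so undoing it means solving a
first-order recurrence. -/
lemma coeff_recurrence (x : LaurentSeries ℂ) (a : ℂ) (n : ℕ) :
    x.coeff ((n + 1 : ℕ) : ℤ) = a * x.coeff n +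
      (polyLaurent (Polynomial.X - Polynomial.C a) * x).coeff n := by
  have : polyLaurent (Polynomial.X - Polynomial.C a) =
      HahnSeries.single (-1) 1 - HahnSeries.C a := by simp [polyLaurent]
  rw [this, sub_mul, HahnSeries.coeff_sub, HahnSeries.C_mul_eq_smul, HahnSeries.coeff_smul,
    HahnSeries.coeff_single_mul]
  simp

/-- Poles are removed one at a time: (z - a) x satisfies the hypothesis with one root fewer, which
is why x and P stay universally quantified. Without roots x is a polynomial in z, with no
coefficients of positive index. Multiple poles need no separate treatment. -/
lemma expDecay_coeff_of_roots (s : Multiset ℂ) (hs : ∀ a ∈ s, ‖a‖ < 1) :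
    ∀ (x : LaurentSeries ℂ) (P : Polynomial ℂ),
      polyLaurent (s.map fun a => Polynomial.X - Polynomial.C a).prod * x = polyLaurent P →
      ExpDecay fun n => x.coeff (n : ℤ) := by
  induction s using Multiset.induction_on with
  | empty =>
    intro x P h
    simp only [Multiset.map_zero, Multiset.prod_zero, map_one, one_mul] at h
    subst h
    refine ⟨‖P.coeff 0‖, 1 / 2, norm_nonneg _, by norm_num, by norm_num, fun n => ?_⟩
    rcases Nat.eq_zero_or_pos n with rfl | hn
    · simpa using (congrArg norm (coeff_polyLaurent_neg P 0)).le
    · have : (polyLaurent P).coeff (n : ℤ) = 0 :=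
        coeff_polyLaurent_pos _ _ (by exact_mod_cast hn)
      simp [this]
  | cons a s ih =>
    intro x P h
    have h1 := ih (fun b hb => hs b (Multiset.mem_cons_of_mem hb))
      (polyLaurent (Polynomial.X - Polynomial.C a) * x) P (by
        rw [← h, Multiset.map_cons, Multiset.prod_cons, map_mul]; ring)
    exact h1.of_recurrence (hs a (Multiset.mem_cons_self a s)) (coeff_recurrence x a)

/-- The impulse response of a stable rational function decays exponentially. -/
lemma expDecay_impulse {f : RatFunc ℂ} (hf : ∀ z, f.denom.IsRoot z → ‖z‖ < 1) :
    ExpDecay (impulse f) := by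
  have h := expDecay_coeff_of_roots f.denom.roots
    (fun a ha => hf a (Polynomial.isRoot_of_mem_roots ha)) (laurentHom f) f.num (by
      rw [← laurentHom_denom_mul]
      congr 2
      exact ((IsAlgClosed.splits f.denom).eq_prod_roots_of_monic f.monic_denom).symm)
  simpa only [← impulse_eq] using h

lemma ratFunc_X_sub_C_ne_zero (a : ℂ) : (RatFunc.X - RatFunc.C a : RatFunc ℂ) ≠ 0 := by
  rw [← RatFunc.algebraMap_X, ← RatFunc.algebraMap_C, ← map_sub]
  exact RatFunc.algebraMap_ne_zero (Polynomial.X_sub_C_ne_zero a)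

/-- Filtering by `1 / (z - a)` with `‖a‖ < 1` preserves exponential decay. -/
lemma ExpDecay.impulse_mul {f : RatFunc ℂ} (hf : ExpDecay (impulse f)) {a : ℂ} (ha : ‖a‖ < 1) :
    ExpDecay (impulse (1 / (RatFunc.X - RatFunc.C a) * f)) := by
  refine hf.of_recurrence ha fun n => ?_
  rw [impulse_eq, coeff_recurrence _ a, impulse_eq, impulse_eq, ← laurentHom_algebraMap, ← map_mul]
  congr 3
  have h0 := ratFunc_X_sub_C_ne_zero a
  rw [map_sub, RatFunc.algebraMap_X, RatFunc.algebraMap_C]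
  field_simp

lemma pole_mem_causal (a : ℂ) :
    laurentHom (1 / (RatFunc.X - RatFunc.C a)) ∈ causal := by
  have h0 := ratFunc_X_sub_C_ne_zero a
  have hx : laurentHom (1 / (RatFunc.X - RatFunc.C a)) ≠ 0 := by
    rw [Ne, map_eq_zero]; exact one_div_ne_zero h0
  have hP : polyLaurent (Polynomial.X - Polynomial.C a) ≠ 0 := by
    rw [Ne, map_eq_zero_iff _ polyLaurent_injective]; exact Polynomial.X_sub_C_ne_zero a
  have h : polyLaurent (Polynomial.X - Polynomial.C a) *
      laurentHom (1 / (RatFunc.X - RatFunc.C a)) = 1 := by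
    rw [← laurentHom_algebraMap, ← map_mul, map_sub, RatFunc.algebraMap_X, RatFunc.algebraMap_C,
      mul_one_div_cancel h0, map_one]
  have ho := congrArg HahnSeries.order h
  rw [HahnSeries.order_mul hP hx, order_polyLaurent (Polynomial.X_sub_C_ne_zero a),
    HahnSeries.order_one, Polynomial.natDegree_X_sub_C] at ho
  rw [mem_causal_iff]
  intro n hn
  apply HahnSeries.coeff_eq_zero_of_lt_order
  push_cast at ho
  omega

end OBF

end

/-! ### Moments and orthogonality of lagged products of white noise. -/

noncomputable section

namespace OBF

/-! ### Lagged noise -/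

section Lag

variable {Ω ι : Type*} {v : ℕ → Ω → ι → ℂ}

/-- The noise component `x.2`, delayed by `x.1` and started at time `0`. -/
def lag (v : ℕ → Ω → ι → ℂ) (t : ℕ) (x : ℕ × ι) (ω : Ω) : ℂ :=
  if x.1 ≤ t then v (t - x.1) ω x.2 else 0

lemma lag_of_le {t : ℕ} {x : ℕ × ι} (h : x.1 ≤ t) : lag v t x = fun ω => v (t - x.1) ω x.2 := by
  ext ω
  rw [lag, if_pos h]

lemma lag_of_lt {t : ℕ} {x : ℕ × ι} (h : t < x.1) : lag v t x = fun _ => 0 := by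
  ext ω
  rw [lag, if_neg h.not_ge]

/-- The information contained in the noise at all times except `n`. -/
abbrev others (v : ℕ → Ω → ι → ℂ) (n : ℕ) : MeasurableSpace Ω :=
  ⨆ k ∈ ({n}ᶜ : Set ℕ), MeasurableSpace.comap (v k) inferInstance

lemma measurable_others {n k : ℕ} (h : k ≠ n) (i : ι) :
    Measurable[others v n] fun ω => v k ω i := by
  have h1 : Measurable[others v n] (v k) := by
    refine Measurable.mono (comap_measurable (v k)) ?_ le_rfl
    exact le_iSup₂_of_le k h le_rfl
  exact (measurable_pi_apply i).comp h1

lemma measurable_comap_coord (n : ℕ) (i : ι) :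
    Measurable[MeasurableSpace.comap (v n) inferInstance] fun ω => v n ω i :=
  (measurable_pi_apply i).comp (comap_measurable (v n))

lemma measurable_lag_others {n t : ℕ} {x : ℕ × ι} (h : x.1 ≤ t → t - x.1 ≠ n) :
    Measurable[others v n] (lag v t x) := by
  rcases le_or_gt x.1 t with hx | hx
  · rw [lag_of_le hx]
    exact measurable_others (h hx) _
  · rw [lag_of_lt hx]
    exact measurable_const

variable [DecidableEq ι]

/-- The centered product of two lagged noise components. -/
def lagProd (v : ℕ → Ω → ι → ℂ) (x y : ℕ × ι) (t : ℕ) (ω : Ω) : ℂ :=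
  lag v t x ω * conj (lag v t y ω) - if x = y ∧ x.1 ≤ t then 1 else 0

lemma measurable_lagProd_others {n t : ℕ} {x y : ℕ × ι} (hx : x.1 ≤ t → t - x.1 ≠ n)
    (hy : y.1 ≤ t → t - y.1 ≠ n) : Measurable[others v n] (lagProd v x y t) :=
  ((measurable_lag_others hx).mul
    (Complex.continuous_conj.measurable.comp (measurable_lag_others hy))).sub measurable_const

lemma lagProd_of_lt_left {x y : ℕ × ι} {t : ℕ} (h : t < x.1) : lagProd v x y t = fun _ => 0 := by
  ext ω
  rw [lagProd, lag_of_lt h, if_neg (by omega)]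
  simp

lemma lagProd_of_lt_right {x y : ℕ × ι} {t : ℕ} (h : t < y.1) : lagProd v x y t = fun _ => 0 := by
  ext ω
  rw [lagProd, lag_of_lt h, if_neg (by rintro ⟨rfl, h'⟩; omega)]
  simp

end Lag

variable {Ω : Type*} [MeasurableSpace Ω]

/-! ### Combining two independent noises -/

/-- Two mutually independent sequences of independent variables form a sequence of independent
pairs. -/
lemma iIndepFun_prodMk_of_indepFun {P : Measure Ω} {α β : Type*}
    [MeasurableSpace α] [MeasurableSpace β] {e : ℕ → Ω → α} {ε : ℕ → Ω → β}
    (he : ∀ t, Measurable (e t)) (hε : ∀ t, Measurable (ε t))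
    (hei : iIndepFun e P) (hεi : iIndepFun ε P)
    (hind : IndepFun (fun ω t => e t ω) (fun ω t => ε t ω) P) :
    iIndepFun (fun t ω => (e t ω, ε t ω)) P := by
  rw [iIndepFun_iff_iIndep]
  -- Measurable rectangles form a π-system generating the product σ-algebra, so independence need
  -- only be tested on them.
  set R : Set (Set (α × β)) :=
    Set.image2 (fun x1 x2 => x1 ×ˢ x2) {s | MeasurableSet s} {t | MeasurableSet t} with hR
  refine iIndepSets.iIndep (fun t => ((he t).prodMk (hε t)).comap_le)
    (fun t => Set.preimage (fun ω => (e t ω, ε t ω)) '' R) (fun t => ?_) (fun t => ?_) ?_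
  · exact isPiSystem_prod.comap _
  · rw [← MeasurableSpace.comap_generateFrom, hR, generateFrom_prod]
  · have hprod : ∀ (S : Finset ℕ) (A : ℕ → Set α) (B : ℕ → Set β),
        (∀ t ∈ S, MeasurableSet (A t)) → (∀ t ∈ S, MeasurableSet (B t)) →
        P ((⋂ t ∈ S, e t ⁻¹' A t) ∩ ⋂ t ∈ S, ε t ⁻¹' B t) =
          ∏ t ∈ S, (P (e t ⁻¹' A t) * P (ε t ⁻¹' B t)) := by
      intro S A B hA hB
      have h1 := hind.measure_inter_preimage_eq_mul
        (⋂ t ∈ S, (fun x : ℕ → α => x t) ⁻¹' A t) (⋂ t ∈ S, (fun x : ℕ → β => x t) ⁻¹' B t)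
        (S.measurableSet_biInter fun t ht => measurable_pi_apply t (hA t ht))
        (S.measurableSet_biInter fun t ht => measurable_pi_apply t (hB t ht))
      simp only [Set.preimage_iInter] at h1
      rw [Finset.prod_mul_distrib, ← hei.measure_inter_preimage_eq_mul S hA,
        ← hεi.measure_inter_preimage_eq_mul S hB]
      exact h1
    rw [iIndepSets_iff]
    intro S f hf
    have hf' : ∀ t, ∃ A : Set α, ∃ B : Set β, t ∈ S → MeasurableSet A ∧ MeasurableSet B ∧
        f t = e t ⁻¹' A ∩ ε t ⁻¹' B := by
      intro t
      by_cases ht : t ∈ S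
      · obtain ⟨_, ⟨A, hA, B, hB, rfl⟩, h⟩ := hf t ht
        exact ⟨A, B, fun _ => ⟨hA, hB, h.symm⟩⟩
      · exact ⟨∅, ∅, fun h => absurd h ht⟩
    choose A B h using hf'
    have h1 : ⋂ t ∈ S, f t = (⋂ t ∈ S, e t ⁻¹' A t) ∩ ⋂ t ∈ S, ε t ⁻¹' B t := by
      ext ω
      simp only [Set.mem_iInter, Set.mem_inter_iff, ← forall_and]
      exact forall₂_congr fun t ht => by rw [(h t ht).2.2]; rfl
    rw [h1, hprod S A B (fun t ht => (h t ht).1) (fun t ht => (h t ht).2.1)]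
    refine Finset.prod_congr rfl fun t ht => ?_
    -- The product formula for a single time identifies each factor as the probability of the joint
    -- event.
    have h2 := hprod {t} A B (fun k hk => by rw [Finset.mem_singleton.1 hk]; exact (h t ht).1)
      (fun k hk => by rw [Finset.mem_singleton.1 hk]; exact (h t ht).2.1)
    simp only [Finset.mem_singleton, Set.iInter_iInter_eq_left, Finset.prod_singleton] at h2
    rw [(h t ht).2.2, h2]

/-- A white noise with independent values and uniformly bounded fourth moments. -/
structure IsWhite {ι : Type*} [DecidableEq ι] (P : Measure Ω) (v : ℕ → Ω → ι → ℂ) (K : ℝ) :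
    Prop where
  measurable : ∀ t, Measurable (v t)
  indep : iIndepFun v P
  memLp : ∀ t i, MemLp (fun ω => v t ω i) 4 P
  nonneg : 0 ≤ K
  fourth : ∀ t i, ∫ ω, ‖v t ω i‖ ^ 4 ∂P ≤ K
  mean_zero : ∀ t i, ∫ ω, v t ω i ∂P = 0
  cov : ∀ t i j, ∫ ω, v t ω i * conj (v t ω j) ∂P = if i = j then 1 else 0

lemma IsIIDNoise.exists_fourth_le {d : ℕ} {P : Measure Ω} {e : ℕ → Ω → Fin d → ℂ}
    (h : IsIIDNoise P e) : ∃ K, 0 ≤ K ∧ ∀ t i, ∫ ω, ‖e t ω i‖ ^ 4 ∂P ≤ K := by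
  have hn : ∀ i, 0 ≤ ∫ ω, ‖e 0 ω i‖ ^ 4 ∂P := fun i => integral_nonneg fun ω => by positivity
  refine ⟨∑ i, ∫ ω, ‖e 0 ω i‖ ^ 4 ∂P, Finset.sum_nonneg fun i _ => hn i, fun t i => ?_⟩
  have h1 : ∫ ω, ‖e t ω i‖ ^ 4 ∂P = ∫ ω, ‖e 0 ω i‖ ^ 4 ∂P :=
    ((h.identDistrib t).comp (u := fun x : Fin d → ℂ => ‖x i‖ ^ 4) (by fun_prop)).integral_eq
  rw [h1]
  exact Finset.single_le_sum (f := fun i => ∫ ω, ‖e 0 ω i‖ ^ 4 ∂P) (fun i _ => hn i)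
    (Finset.mem_univ i)

/-- The two noises side by side. -/
def joinNoise {r s : ℕ} (e : ℕ → Ω → Fin r → ℂ) (ε : ℕ → Ω → Fin s → ℂ) (t : ℕ) (ω : Ω) :
    Fin r ⊕ Fin s → ℂ := Sum.elim (e t ω) (ε t ω)

lemma isWhite_joinNoise {r s : ℕ} {P : Measure Ω} {e : ℕ → Ω → Fin r → ℂ}
    {ε : ℕ → Ω → Fin s → ℂ} (he : IsIIDNoise P e) (hε : IsIIDNoise P ε)
    (hind : IndepFun (fun ω t => e t ω) (fun ω t => ε t ω) P) :
    ∃ K, IsWhite P (joinNoise e ε) K := by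
  obtain ⟨K₁, hK₁, h₁⟩ := he.exists_fourth_le
  obtain ⟨K₂, hK₂, h₂⟩ := hε.exists_fourth_le
  have hmeas : Measurable fun x : (Fin r → ℂ) × (Fin s → ℂ) => Sum.elim x.1 x.2 := by
    refine measurable_pi_lambda _ fun i => ?_
    rcases i with i | i
    · exact (measurable_pi_apply i).comp measurable_fst
    · exact (measurable_pi_apply i).comp measurable_snd
  have hcross : ∀ t i j, ∫ ω, e t ω i * conj (ε t ω j) ∂P = 0 := by
    intro t i j
    have hi : IndepFun (fun ω => e t ω i) (fun ω => conj (ε t ω j)) P :=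
      hind.comp (φ := fun x : ℕ → Fin r → ℂ => x t i)
        (ψ := fun x : ℕ → Fin s → ℂ => conj (x t j)) (by fun_prop)
        (Complex.continuous_conj.measurable.comp (by fun_prop))
    rw [hi.integral_fun_mul_eq_mul_integral (he.fourthMoment t i).1
      (Complex.continuous_conj.comp_aestronglyMeasurable (hε.fourthMoment t j).1), he.mean_zero,
      zero_mul]
  refine ⟨K₁ + K₂, ?_, ?_, ?_, by positivity, ?_, ?_, ?_⟩
  · exact fun t => hmeas.comp ((he.measurable t).prodMk (hε.measurable t))
  · exact (iIndepFun_prodMk_of_indepFun he.measurable hε.measurable he.indep hε.indep hind).comp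
      (fun _ x => Sum.elim x.1 x.2) (fun _ => hmeas)
  · rintro t (i | i)
    · exact he.fourthMoment t i
    · exact hε.fourthMoment t i
  · rintro t (i | i)
    · exact (h₁ t i).trans (by linarith)
    · exact (h₂ t i).trans (by linarith)
  · rintro t (i | i)
    · exact he.mean_zero t i
    · exact hε.mean_zero t i
  · rintro t (i | i) (j | j)
    · simpa [joinNoise] using he.unit_cov t i j
    · simpa [joinNoise] using hcross t i j
    · have := congrArg conj (hcross t j i)
      rw [← integral_conj] at this
      simpa [joinNoise, mul_comm] using this
    · simpa [joinNoise] using hε.unit_cov t i j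

/-- The second moment of a sum of pairwise orthogonal variables. -/
lemma integral_norm_sq_sum_le {P : Measure Ω} {f : ℕ → Ω → ℂ} {B : ℝ} (hf : ∀ t, MemLp (f t) 2 P)
    (ho : ∀ s t, s ≠ t → ∫ ω, f t ω * conj (f s ω) ∂P = 0)
    (hB : ∀ t, ∫ ω, ‖f t ω‖ ^ 2 ∂P ≤ B) (S : Finset ℕ) :
    ∫ ω, ‖∑ t ∈ S, f t ω‖ ^ 2 ∂P ≤ S.card * B := by
  have hi : ∀ s t, Integrable (fun ω => f t ω * conj (f s ω)) P := fun s t =>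
    MemLp.integrable_mul (hf t) (hf s).star
  have h1 : ((∫ ω, ‖∑ t ∈ S, f t ω‖ ^ 2 ∂P : ℝ) : ℂ) =
      ((∑ t ∈ S, ∫ ω, ‖f t ω‖ ^ 2 ∂P : ℝ) : ℂ) := by
    rw [← integral_complex_ofReal]
    have e : ∀ ω, ((‖∑ t ∈ S, f t ω‖ ^ 2 : ℝ) : ℂ) =
        ∑ t ∈ S, ∑ s ∈ S, f t ω * conj (f s ω) := by
      intro ω
      rw [Complex.ofReal_pow, ← Complex.mul_conj', map_sum, Finset.sum_mul_sum]
    simp only [e]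
    rw [integral_finsetSum _ fun t _ => integrable_finsetSum _ fun s _ => hi s t,
      Complex.ofReal_sum]
    refine Finset.sum_congr rfl fun t ht => ?_
    rw [integral_finsetSum _ fun s _ => hi s t, Finset.sum_eq_single t
      (fun s _ hs => ho s t hs) (fun h => absurd ht h), ← integral_complex_ofReal]
    congr 1
    ext ω
    rw [Complex.mul_conj', Complex.ofReal_pow]
  rw [Complex.ofReal_inj.1 h1, ← nsmul_eq_mul]
  exact Finset.sum_le_card_nsmul _ _ _ fun t _ => hB t

/-! ### Lagged products of white noise -/

section White

variable {ι : Type*} [DecidableEq ι] {P : Measure Ω} {v : ℕ → Ω → ι → ℂ} {K : ℝ}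

/-- The value at time n is independent of the σ-algebra of all other times, so the expectation
factors. All orthogonality relations below use independence in this form. -/
lemma IsWhite.integral_mul_eq_zero (hv : IsWhite P v K) (n : ℕ) {A F : Ω → ℂ}
    (hA : Measurable[MeasurableSpace.comap (v n) inferInstance] A)
    (hF : Measurable[others v n] F) (hA0 : ∫ ω, A ω ∂P = 0) : ∫ ω, A ω * F ω ∂P = 0 := by
  have hle : ∀ k, MeasurableSpace.comap (v k) inferInstance ≤ (inferInstance : MeasurableSpace Ω) :=
    fun k => (hv.measurable k).comap_le
  have h1 : Indep (⨆ k ∈ ({n} : Set ℕ), MeasurableSpace.comap (v k) inferInstance)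
      (others v n) P :=
    indep_iSup_of_disjoint hle ((iIndepFun_iff_iIndep _ _ _).1 hv.indep)
      (disjoint_compl_right (a := ({n} : Set ℕ)))
  rw [iSup_singleton] at h1
  have hi : IndepFun A F P := by
    rw [IndepFun_iff_Indep]
    exact indep_of_indep_of_le h1 hA.comap_le hF.comap_le
  have hole : others v n ≤ (inferInstance : MeasurableSpace Ω) := iSup₂_le fun k _ => hle k
  rw [hi.integral_fun_mul_eq_mul_integral (hA.mono (hle n) le_rfl).aestronglyMeasurable
    (hF.mono hole le_rfl).aestronglyMeasurable, hA0, zero_mul]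

lemma integral_conj_eq_zero {A : Ω → ℂ} (h : ∫ ω, A ω ∂P = 0) : ∫ ω, conj (A ω) ∂P = 0 := by
  rw [integral_conj, h, map_zero]

lemma IsWhite.integral_lag_mul (hv : IsWhite P v K) (t : ℕ) (x y : ℕ × ι) :
    ∫ ω, lag v t x ω * conj (lag v t y ω) ∂P = if x = y ∧ x.1 ≤ t then 1 else 0 := by
  rcases lt_or_ge t x.1 with hx | hx
  · rw [if_neg (by omega), lag_of_lt hx]
    simp
  rcases lt_or_ge t y.1 with hy | hy
  · rw [if_neg (by rintro ⟨rfl, h⟩; omega), lag_of_lt hy]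
    simp
  rw [lag_of_le hx, lag_of_le hy]
  by_cases hxy : x.1 = y.1
  · rw [hxy, hv.cov]
    congr 1
    rw [Prod.ext_iff]
    simp [hxy, hy]
  · rw [if_neg (by rintro ⟨rfl, -⟩; exact hxy rfl)]
    exact hv.integral_mul_eq_zero (t - x.1) (measurable_comap_coord _ _)
      (Complex.continuous_conj.measurable.comp (measurable_others (by omega) _))
      (hv.mean_zero _ _)

lemma IsWhite.memLp_lag (hv : IsWhite P v K) (t : ℕ) (x : ℕ × ι) : MemLp (lag v t x) 4 P := by
  rcases lt_or_ge t x.1 with hx | hx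
  · rw [lag_of_lt hx]
    exact MemLp.zero
  · rw [lag_of_le hx]
    exact hv.memLp _ _

lemma holderTriple_four : ENNReal.HolderTriple 4 4 2 := by
  refine ⟨?_⟩
  rw [← two_mul, show (4 : ENNReal) = 2 * 2 by norm_num, ENNReal.mul_inv (by simp) (by simp),
    ← mul_assoc, ENNReal.mul_inv_cancel (by simp) (by simp), one_mul]

/-- Here fourth moments are needed: the products themselves must be square integrable. -/
lemma IsWhite.memLp_lag_mul (hv : IsWhite P v K) (t : ℕ) (x y : ℕ × ι) :
    MemLp (fun ω => lag v t x ω * conj (lag v t y ω)) 2 P := by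
  have := holderTriple_four
  exact (hv.memLp_lag t y).star.mul (hv.memLp_lag t x)

lemma IsWhite.integral_lag_pow_le (hv : IsWhite P v K) (t : ℕ) (x : ℕ × ι) :
    ∫ ω, ‖lag v t x ω‖ ^ 4 ∂P ≤ K := by
  rcases lt_or_ge t x.1 with hx | hx
  · rw [lag_of_lt hx]
    simpa using hv.nonneg
  · rw [lag_of_le hx]
    exact hv.fourth _ _

variable [IsProbabilityMeasure P]

lemma IsWhite.memLp_lagProd (hv : IsWhite P v K) (x y : ℕ × ι) (t : ℕ) :
    MemLp (lagProd v x y t) 2 P :=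
  (hv.memLp_lag_mul t x y).sub (memLp_const _)

lemma IsWhite.integrable_lag_mul (hv : IsWhite P v K) (t : ℕ) (x y : ℕ × ι) :
    Integrable (fun ω => lag v t x ω * conj (lag v t y ω)) P :=
  (hv.memLp_lag_mul t x y).integrable (by norm_num)

lemma IsWhite.integral_lagProd (hv : IsWhite P v K) (x y : ℕ × ι) (t : ℕ) :
    ∫ ω, lagProd v x y t ω ∂P = 0 := by
  simp only [lagProd]
  rw [integral_sub (hv.integrable_lag_mul t x y) (integrable_const _), hv.integral_lag_mul]
  simp

/-- Centered lagged products at different times are orthogonal. -/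
lemma IsWhite.lagProd_orthogonal (hv : IsWhite P v K) (x y : ℕ × ι) {s t : ℕ} (hst : s ≠ t) :
    ∫ ω, lagProd v x y t ω * conj (lagProd v x y s ω) ∂P = 0 := by
  wlog h : s < t generalizing s t
  · have h1 := this hst.symm (lt_of_le_of_ne (not_lt.1 h) hst.symm)
    have h2 := integral_conj_eq_zero h1
    simpa [mul_comm] using h2
  rcases lt_or_ge t x.1 with hx | hx
  · simp [lagProd_of_lt_left hx]
  rcases lt_or_ge t y.1 with hy | hy
  · simp [lagProd_of_lt_right hy]
  have hconj : ∀ {m : MeasurableSpace Ω} {F : Ω → ℂ}, Measurable[m] F →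
      Measurable[m] fun ω => conj (F ω) :=
    fun hF => Complex.continuous_conj.measurable.comp hF
  -- If the lags differ, the most recent noise value among the four factors occurs once, has mean
  -- zero, and is independent of the rest; no centring constant is present. If they agree, the whole
  -- centred product at time t plays this role.
  rcases lt_trichotomy x.1 y.1 with hxy | hxy | hxy
  · have e : ∀ ω, lagProd v x y t ω * conj (lagProd v x y s ω) =
        v (t - x.1) ω x.2 * (conj (v (t - y.1) ω y.2) * conj (lagProd v x y s ω)) := by
      intro ω
      rw [lagProd, if_neg (by rintro ⟨rfl, -⟩; omega), lag_of_le hx, lag_of_le hy]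
      ring
    simp only [e]
    exact hv.integral_mul_eq_zero (t - x.1) (measurable_comap_coord _ _)
      ((hconj (measurable_others (by omega) _)).mul
        (hconj (measurable_lagProd_others (by omega) (by omega)))) (hv.mean_zero _ _)
  · have hm : Measurable[MeasurableSpace.comap (v (t - x.1)) inferInstance] (lagProd v x y t) := by
      unfold lagProd
      rw [lag_of_le hx, lag_of_le hy, ← hxy]
      exact ((measurable_comap_coord _ _).mul (hconj (measurable_comap_coord _ _))).sub
        measurable_const
    exact hv.integral_mul_eq_zero (t - x.1) hm
      (hconj (measurable_lagProd_others (by omega) (by omega))) (hv.integral_lagProd x y t)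
  · have e : ∀ ω, lagProd v x y t ω * conj (lagProd v x y s ω) =
        conj (v (t - y.1) ω y.2) * (v (t - x.1) ω x.2 * conj (lagProd v x y s ω)) := by
      intro ω
      rw [lagProd, if_neg (by rintro ⟨rfl, -⟩; omega), lag_of_le hx, lag_of_le hy]
      ring
    simp only [e]
    exact hv.integral_mul_eq_zero (t - y.1) (hconj (measurable_comap_coord _ _))
      ((measurable_others (by omega) _).mul
        (hconj (measurable_lagProd_others (by omega) (by omega))))
      (integral_conj_eq_zero (hv.mean_zero _ _))

/-- Pointwise, (ab + 1)² ≤ 2a²b² + 2 ≤ a⁴ + b⁴ + 2. The bound is uniform in the lags and in time, as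
the later summation over lags requires. -/
lemma IsWhite.integral_lagProd_sq_le (hv : IsWhite P v K) (x y : ℕ × ι) (t : ℕ) :
    ∫ ω, ‖lagProd v x y t ω‖ ^ 2 ∂P ≤ 2 * K + 2 := by
  have hint : ∀ z, Integrable (fun ω => ‖lag v t z ω‖ ^ 4) P := fun z =>
    (hv.memLp_lag t z).integrable_norm_pow (p := 4) (by norm_num)
  have hb : ∀ ω, ‖lagProd v x y t ω‖ ^ 2 ≤ ‖lag v t x ω‖ ^ 4 + ‖lag v t y ω‖ ^ 4 + 2 := by
    intro ω
    set c : ℂ := if x = y ∧ x.1 ≤ t then 1 else 0 with hc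
    have hc1 : ‖c‖ ≤ 1 := by rw [hc]; split_ifs <;> simp
    have h1 : ‖lagProd v x y t ω‖ ≤ ‖lag v t x ω‖ * ‖lag v t y ω‖ + 1 := by
      refine (norm_sub_le _ _).trans (add_le_add (le_of_eq ?_) hc1)
      rw [norm_mul, RCLike.norm_conj]
    have h2 : ‖lagProd v x y t ω‖ ^ 2 ≤ (‖lag v t x ω‖ * ‖lag v t y ω‖ + 1) ^ 2 :=
      pow_le_pow_left₀ (norm_nonneg _) h1 2
    nlinarith [sq_nonneg (‖lag v t x ω‖ * ‖lag v t y ω‖ - 1),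
      sq_nonneg (‖lag v t x ω‖ ^ 2 - ‖lag v t y ω‖ ^ 2)]
  calc ∫ ω, ‖lagProd v x y t ω‖ ^ 2 ∂P
      ≤ ∫ ω, (‖lag v t x ω‖ ^ 4 + ‖lag v t y ω‖ ^ 4 + 2) ∂P :=
        integral_mono ((memLp_two_iff_integrable_sq_norm (hv.memLp_lagProd x y t).1).1
          (hv.memLp_lagProd x y t))
          (((hint x).add (hint y)).add (integrable_const _)) hb
    _ = ∫ ω, ‖lag v t x ω‖ ^ 4 ∂P + ∫ ω, ‖lag v t y ω‖ ^ 4 ∂P + 2 := by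
        rw [integral_add (f := fun ω => ‖lag v t x ω‖ ^ 4 + ‖lag v t y ω‖ ^ 4)
          ((hint x).add (hint y)) (integrable_const _), integral_add (hint x) (hint y)]
        simp
    _ ≤ 2 * K + 2 := by
        have := hv.integral_lag_pow_le t x
        have := hv.integral_lag_pow_le t y
        linarith

end White

end OBF

end

/-! ### From second moments of block sums to almost sure rates. -/

noncomputable section

namespace OBF

/-! ### Sequences of order `N ^ (-1/2 + δ)` -/

/-- `x N = o(N ^ (-1/2 + δ))` for every `δ > 0`. -/
def HasRate (x : ℕ → ℂ) : Prop :=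
  ∀ δ : ℝ, 0 < δ → x =o[atTop] fun N : ℕ => (N : ℝ) ^ (-(1 / 2 : ℝ) + δ)

lemma HasRate.add {x y : ℕ → ℂ} (hx : HasRate x) (hy : HasRate y) :
    HasRate fun N => x N + y N := fun δ hδ => (hx δ hδ).add (hy δ hδ)

lemma HasRate.sub {x y : ℕ → ℂ} (hx : HasRate x) (hy : HasRate y) :
    HasRate fun N => x N - y N := fun δ hδ => (hx δ hδ).sub (hy δ hδ)

lemma HasRate.sum {κ : Type*} {s : Finset κ} {x : κ → ℕ → ℂ} (hx : ∀ k ∈ s, HasRate (x k)) :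
    HasRate fun N => ∑ k ∈ s, x k N :=
  fun δ hδ => by
    simpa only [Finset.sum_fn] using Asymptotics.IsLittleO.sum fun k hk => hx k hk δ hδ

lemma HasRate.bdd_mul {x y : ℕ → ℂ} (hy : y =O[atTop] fun _ => (1 : ℝ)) (hx : HasRate x) :
    HasRate fun N => y N * x N := fun δ hδ => by
  simpa using hy.mul_isLittleO (hx δ hδ)

lemma HasRate.const_mul {x : ℕ → ℂ} (c : ℂ) (hx : HasRate x) : HasRate fun N => c * x N :=
  fun δ hδ => (hx δ hδ).const_mul_left c

lemma HasRate.tendsto_zero {x : ℕ → ℂ} (hx : HasRate x) : Tendsto x atTop (𝓝 0) := by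
  have h1 := hx (1 / 4) (by norm_num)
  refine h1.trans_tendsto ?_
  have h2 := (tendsto_rpow_neg_atTop (y := 1 / 4) (by norm_num)).comp tendsto_natCast_atTop_atTop
  refine h2.congr fun N => ?_
  norm_num

lemma isLittleO_rpow_rpow {a b : ℝ} (h : a < b) :
    (fun N : ℕ => (N : ℝ) ^ a) =o[atTop] fun N : ℕ => (N : ℝ) ^ b := by
  refine (Asymptotics.isLittleO_of_tendsto' ?_ ?_ : (fun x : ℝ => x ^ a) =o[atTop]
    fun x : ℝ => x ^ b).comp_tendsto tendsto_natCast_atTop_atTop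
  · filter_upwards [eventually_gt_atTop 0] with x hx h0
    exact absurd h0 (Real.rpow_pos_of_pos hx b).ne'
  · refine (tendsto_rpow_neg_atTop (sub_pos.2 h)).congr' ?_
    filter_upwards [eventually_gt_atTop 0] with x hx
    rw [neg_sub, Real.rpow_sub hx]

/-- Countably many exponents suffice, so almost sure bounds for each of them can be intersected. -/
lemma hasRate_of_isBigO {x : ℕ → ℂ}
    (h : ∀ n : ℕ, x =O[atTop] fun N : ℕ => (N : ℝ) ^ (-(1 / 2 : ℝ) + 1 / (n + 1))) :
    HasRate x := by
  intro δ hδ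
  obtain ⟨n, hn⟩ := exists_nat_one_div_lt hδ
  exact (h n).trans_isLittleO (isLittleO_rpow_rpow (by linarith))

/-! ### A maximal inequality -/

/-- Sum of the squared norms of all dyadic block sums in a block of length `2 ^ k`. -/
def dyadicSum (X : ℕ → ℂ) : ℕ → ℕ → ℝ
  | 0, a => ‖X a‖ ^ 2
  | k + 1, a => ‖∑ t ∈ Finset.range (2 ^ k), X (a + t)‖ ^ 2 + dyadicSum X k a +
      dyadicSum X k (a + 2 ^ k)

lemma dyadicSum_nonneg (X : ℕ → ℂ) (k a : ℕ) : 0 ≤ dyadicSum X k a := by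
  induction k generalizing a with
  | zero => exact sq_nonneg _
  | succ k ih =>
    have := ih a
    have := ih (a + 2 ^ k)
    rw [dyadicSum]
    positivity

/-- The binary expansion of n cuts the partial sum into at most k + 1 dyadic blocks, and
Cauchy–Schwarz costs the factor k + 1. -/
lemma norm_sum_sq_le_dyadicSum (X : ℕ → ℂ) (k : ℕ) : ∀ a n, n ≤ 2 ^ k →
    ‖∑ t ∈ Finset.range n, X (a + t)‖ ^ 2 ≤ (k + 1) * dyadicSum X k a := by
  induction k with
  | zero =>
    intro a n hn
    interval_cases n
    · simpa using dyadicSum_nonneg X 0 a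
    · simp [dyadicSum]
  | succ k ih =>
    intro a n hn
    have h1 := dyadicSum_nonneg X k a
    have h2 := dyadicSum_nonneg X k (a + 2 ^ k)
    have hk : (0 : ℝ) ≤ k := Nat.cast_nonneg k
    rw [dyadicSum]
    push_cast
    rcases le_or_gt n (2 ^ k) with h | h
    · have h3 := ih a n h
      have h4 := sq_nonneg ‖∑ t ∈ Finset.range (2 ^ k), X (a + t)‖
      nlinarith [mul_nonneg hk h2, mul_nonneg hk h4]
    · obtain ⟨l, rfl⟩ := Nat.exists_eq_add_of_lt h
      rw [show 2 ^ k + l + 1 = 2 ^ k + (l + 1) by ring, Finset.sum_range_add]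
      have h3 := ih (a + 2 ^ k) (l + 1) (by rw [pow_succ] at hn; omega)
      simp only [← add_assoc] at h3 ⊢
      set A := ∑ t ∈ Finset.range (2 ^ k), X (a + t)
      set B := ∑ t ∈ Finset.range (l + 1), X (a + 2 ^ k + t)
      have h5 : ‖A + B‖ ^ 2 ≤ (‖A‖ + ‖B‖) ^ 2 :=
        pow_le_pow_left₀ (norm_nonneg _) (norm_add_le _ _) 2
      -- This is (a + b)² ≤ (k+2) a² + (k+2)/(k+1) b² multiplied by k + 1; the weights are those
      -- that raise the factor from k + 1 to exactly k + 2.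
      have h6 : (‖A‖ + ‖B‖) ^ 2 * (k + 1) ≤
          ((k + 2) * ‖A‖ ^ 2) * (k + 1) + (k + 2) * ‖B‖ ^ 2 := by
        nlinarith [sq_nonneg ((k + 1) * ‖A‖ - ‖B‖)]
      have h7 : (k + 2) * ‖B‖ ^ 2 ≤ (k + 2) * dyadicSum X k (a + 2 ^ k) * (k + 1) := by
        nlinarith
      have h8 : ‖A + B‖ ^ 2 ≤ (k + 2) * ‖A‖ ^ 2 + (k + 2) * dyadicSum X k (a + 2 ^ k) := by
        refine le_of_mul_le_mul_right ?_ (by positivity : (0 : ℝ) < k + 1)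
        nlinarith
      nlinarith [mul_nonneg hk h1]

variable {Ω : Type*} [MeasurableSpace Ω] {P : Measure Ω}

lemma integrable_dyadicSum {X : ℕ → Ω → ℂ} (hX : ∀ t, MemLp (X t) 2 P) (k : ℕ) :
    ∀ a, Integrable (fun ω => dyadicSum (fun t => X t ω) k a) P := by
  induction k with
  | zero => exact fun a => (hX a).integrable_norm_pow (p := 2) (by norm_num)
  | succ k ih =>
    intro a
    refine Integrable.add (Integrable.add ?_ (ih a)) (ih _)
    exact (memLp_finsetSum _ fun t _ => hX (a + t)).integrable_norm_pow (p := 2) (by norm_num)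

/-- The blocks of one level are disjoint and together contribute at most C * 2 ^ k; there are k + 1
levels. -/
lemma integral_dyadicSum_le {X : ℕ → Ω → ℂ} {C : ℝ} (hX : ∀ t, MemLp (X t) 2 P)
    (hC : ∀ a n, ∫ ω, ‖∑ t ∈ Finset.range n, X (a + t) ω‖ ^ 2 ∂P ≤ C * n) (k : ℕ) :
    ∀ a, ∫ ω, dyadicSum (fun t => X t ω) k a ∂P ≤ (k + 1) * (C * 2 ^ k) := by
  have hC0 : 0 ≤ C := by
    have := hC 0 1
    have h0 : 0 ≤ ∫ ω, ‖∑ t ∈ Finset.range 1, X (0 + t) ω‖ ^ 2 ∂P :=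
      integral_nonneg fun ω => by positivity
    norm_num at this h0
    linarith
  induction k with
  | zero =>
    intro a
    simpa [dyadicSum] using hC a 1
  | succ k ih =>
    intro a
    have hi : Integrable (fun ω => ‖∑ t ∈ Finset.range (2 ^ k), X (a + t) ω‖ ^ 2) P :=
      (memLp_finsetSum _ fun t _ => hX (a + t)).integrable_norm_pow (p := 2) (by norm_num)
    simp only [dyadicSum]
    rw [integral_add (f := fun ω => ‖∑ t ∈ Finset.range (2 ^ k), X (a + t) ω‖ ^ 2 +
        dyadicSum (fun t => X t ω) k a) (hi.add (integrable_dyadicSum hX k a))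
        (integrable_dyadicSum hX k _),
      integral_add hi (integrable_dyadicSum hX k a)]
    have h1 := ih a
    have h2 := ih (a + 2 ^ k)
    have h3 := hC a (2 ^ k)
    push_cast at h3 ⊢
    have : (0 : ℝ) ≤ C * 2 ^ k := by positivity
    rw [pow_succ]
    nlinarith

/-- A sequence of nonnegative functions with summable integrals is almost surely bounded. -/
lemma ae_exists_bound {f : ℕ → Ω → ℝ} (hf : ∀ k, Integrable (f k) P) (h0 : ∀ k ω, 0 ≤ f k ω)
    (hs : Summable fun k => ∫ ω, f k ω ∂P) : ∀ᵐ ω ∂P, ∃ Z, ∀ k, f k ω ≤ Z := by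
  have h1 : ∫⁻ ω, ∑' k, ENNReal.ofReal (f k ω) ∂P ≠ ⊤ := by
    rw [lintegral_tsum fun k => (hf k).1.aemeasurable.ennreal_ofReal]
    simp_rw [← fun k => ofReal_integral_eq_lintegral_ofReal (hf k) (ae_of_all _ (h0 k))]
    exact hs.tsum_ofReal_ne_top
  filter_upwards [ae_lt_top' (AEMeasurable.tsum
    fun k => (hf k).1.aemeasurable.ennreal_ofReal) h1] with ω hω
  refine ⟨(∑' k, ENNReal.ofReal (f k ω)).toReal, fun k => ?_⟩
  rw [← ENNReal.ofReal_le_iff_le_toReal hω.ne]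
  exact ENNReal.le_tsum k

/-- The maximal inequality costs a factor (k + 1)² at scale 2 ^ k, that is, a squared logarithm. The
extra exponent δ supplies the geometric factor τ ^ k = (2 ^ k) ^ (-2δ), which makes the normalized
expectations summable over the scales. -/
lemma ae_isBigO_sum {X : ℕ → Ω → ℂ} {C : ℝ} (hX : ∀ t, MemLp (X t) 2 P)
    (hC : ∀ a n, ∫ ω, ‖∑ t ∈ Finset.range n, X (a + t) ω‖ ^ 2 ∂P ≤ C * n) {δ : ℝ}
    (hδ : 0 < δ) :
    ∀ᵐ ω ∂P, (fun N => ∑ t ∈ Finset.range N, X t ω) =O[atTop]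
      fun N : ℕ => (N : ℝ) ^ (1 / 2 + δ) := by
  set τ : ℝ := (2 : ℝ) ^ (-(2 * δ)) with hτ
  have hτ0 : 0 < τ := by positivity
  have hτ1 : τ < 1 := Real.rpow_lt_one_of_one_lt_of_neg (by norm_num) (by linarith)
  have hpow : ∀ k : ℕ, τ ^ k * (2 ^ k) ^ (2 * δ) = (1 : ℝ) := by
    intro k
    rw [← Real.rpow_natCast 2 k, ← Real.rpow_mul (by norm_num), mul_comm (k : ℝ),
      Real.rpow_mul (by norm_num), Real.rpow_natCast, ← mul_pow, hτ,
      ← Real.rpow_add (by norm_num)]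
    simp
  set f : ℕ → Ω → ℝ := fun k ω => ((k + 1) * τ ^ k / 2 ^ k) * dyadicSum (fun t => X t ω) k 0
    with hf
  have hfi : ∀ k, Integrable (f k) P := fun k => (integrable_dyadicSum hX k 0).const_mul _
  have hf0 : ∀ k ω, 0 ≤ f k ω := fun k ω =>
    mul_nonneg (by positivity) (dyadicSum_nonneg _ _ _)
  have hfs : Summable fun k => ∫ ω, f k ω ∂P := by
    have hs : Summable fun k : ℕ => C * (((k : ℝ) + 1) ^ 2 * τ ^ k) := by
      have h := summable_pow_mul_geometric_of_norm_lt_one (R := ℝ) 2 (r := τ)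
        (by rw [Real.norm_eq_abs, abs_of_pos hτ0]; exact hτ1)
      have h' := ((summable_nat_add_iff 1).2 h).mul_left (C * τ⁻¹)
      refine h'.congr fun k => ?_
      push_cast
      field_simp
      ring
    refine Summable.of_nonneg_of_le (fun k => integral_nonneg (hf0 k)) (fun k => ?_) hs
    rw [hf]
    simp only
    rw [integral_const_mul]
    calc _ ≤ ((k + 1) * τ ^ k / 2 ^ k) * ((k + 1) * (C * 2 ^ k)) :=
          mul_le_mul_of_nonneg_left (integral_dyadicSum_le hX hC k 0) (by positivity)
      _ = C * (((k : ℝ) + 1) ^ 2 * τ ^ k) := by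
          field_simp
  filter_upwards [ae_exists_bound hfi hf0 hfs] with ω hω
  obtain ⟨Z, hZ⟩ := hω
  have hZ0 : 0 ≤ Z := (hf0 0 ω).trans (hZ 0)
  refine Asymptotics.IsBigO.of_bound (Real.sqrt (Z * 2 ^ (1 + 2 * δ))) ?_
  filter_upwards [eventually_gt_atTop 1] with N hN
  -- The least scale with N ≤ 2 ^ k. Since 2 ^ k ≤ 2 N, passing from the scale back to N costs only
  -- 2 ^ (1 + 2δ).
  set k := Nat.clog 2 N with hk
  have hk1 : N ≤ 2 ^ k := Nat.le_pow_clog (by norm_num) N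
  have hk2 : (2 : ℝ) ^ k ≤ 2 * N := by
    have h1 : 2 ^ k.pred < N := Nat.pow_pred_clog_lt_self (by norm_num) hN
    have h2 : 0 < k := Nat.clog_pos (by norm_num) hN
    have h3 : 2 ^ k = 2 * 2 ^ k.pred := by
      rw [← pow_succ', ← Nat.succ_eq_add_one, Nat.succ_pred_eq_of_pos h2]
    have : 2 ^ k ≤ 2 * N := by omega
    exact_mod_cast this
  have hN0 : (0 : ℝ) < N := by exact_mod_cast (by omega : 0 < N)
  have h1 := norm_sum_sq_le_dyadicSum (fun t => X t ω) k 0 N hk1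
  simp only [zero_add] at h1
  have h2 : ((k : ℝ) + 1) * dyadicSum (fun t => X t ω) k 0 = f k ω * (2 ^ k) ^ (1 + 2 * δ) := by
    rw [hf, Real.rpow_add (by positivity), Real.rpow_one]
    have := hpow k
    simp only
    calc _ = ((k : ℝ) + 1) * dyadicSum (fun t => X t ω) k 0 * (τ ^ k * (2 ^ k) ^ (2 * δ)) := by
          rw [this, mul_one]
      _ = _ := by field_simp
  have h3 : f k ω * (2 ^ k) ^ (1 + 2 * δ) ≤ Z * (2 * N) ^ (1 + 2 * δ) := by
    gcongr
    exact hZ k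
  have h4 : Z * (2 * (N : ℝ)) ^ (1 + 2 * δ) = Z * 2 ^ (1 + 2 * δ) * ((N : ℝ) ^ (1 / 2 + δ)) ^ 2 := by
    rw [Real.mul_rpow (by norm_num) hN0.le, ← Real.rpow_natCast ((N : ℝ) ^ (1 / 2 + δ)) 2,
      ← Real.rpow_mul hN0.le]
    push_cast
    rw [show (1 / 2 + δ) * 2 = 1 + 2 * δ by ring]
    ring
  rw [Real.norm_of_nonneg (by positivity : (0 : ℝ) ≤ (N : ℝ) ^ (1 / 2 + δ))]
  refine le_of_sq_le_sq ?_ (by positivity)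
  rw [mul_pow, Real.sq_sqrt (by positivity), ← h4]
  linarith

/-- Strong law of large numbers with a rate. -/
lemma ae_hasRate_average {X : ℕ → Ω → ℂ} {C : ℝ} (hX : ∀ t, MemLp (X t) 2 P)
    (hC : ∀ a n, ∫ ω, ‖∑ t ∈ Finset.range n, X (a + t) ω‖ ^ 2 ∂P ≤ C * n) :
    ∀ᵐ ω ∂P, HasRate fun N => (1 / (N : ℂ)) * ∑ t ∈ Finset.Icc 1 N, X t ω := by
  -- The averages run over 1, …, N and not over 0, …, N - 1, hence the shift by one.
  have hC' : ∀ a n, ∫ ω, ‖∑ t ∈ Finset.range n, X (a + t + 1) ω‖ ^ 2 ∂P ≤ C * n := by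
    intro a n
    simpa only [add_right_comm] using hC (a + 1) n
  have h := ae_all_iff.2 fun n : ℕ => ae_isBigO_sum (X := fun t => X (t + 1))
    (fun t => hX (t + 1)) hC' (δ := 1 / (n + 1)) (by positivity)
  filter_upwards [h] with ω hω
  refine hasRate_of_isBigO fun n => ?_
  have h1 : (fun N : ℕ => (1 / (N : ℂ))) =O[atTop] fun N : ℕ => (N : ℝ) ^ (-1 : ℝ) := by
    refine Asymptotics.isBigO_of_le _ fun N => ?_
    rw [Real.rpow_neg_one]
    simp
  have h2 := h1.mul (hω n)
  refine (h2.congr' (Eventually.of_forall fun N => ?_) ?_)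
  · simp only
    rw [Finset.range_eq_Ico, Finset.sum_Ico_add' (fun t => X t ω) 0 N 1]
    rfl
  · filter_upwards [eventually_gt_atTop 0] with N hN
    rw [← Real.rpow_add (by exact_mod_cast hN)]
    congr 1
    ring

end OBF

end

/-! ### Time averages of products of filtered white noises. -/

noncomputable section

namespace OBF

/-! ### Exponentially decaying sequences -/

lemma ExpDecay.add {x y : ℕ → ℂ} (hx : ExpDecay x) (hy : ExpDecay y) :
    ExpDecay fun n => x n + y n := by
  obtain ⟨C, ρ, hC, h0, h1, hb⟩ := hx
  obtain ⟨D, τ, hD, k0, k1, kb⟩ := hy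
  refine ⟨C + D, max ρ τ, by positivity, lt_max_of_lt_left h0, max_lt h1 k1, fun n => ?_⟩
  calc ‖x n + y n‖ ≤ C * ρ ^ n + D * τ ^ n := (norm_add_le _ _).trans (add_le_add (hb n) (kb n))
    _ ≤ C * max ρ τ ^ n + D * max ρ τ ^ n := by
        gcongr
        · exact le_max_left _ _
        · exact le_max_right _ _
    _ = _ := by ring

lemma ExpDecay.zero : ExpDecay fun _ => 0 :=
  ⟨0, 1 / 2, le_rfl, by norm_num, by norm_num, fun n => by simp⟩

lemma ExpDecay.sum {κ : Type*} (s : Finset κ) {x : κ → ℕ → ℂ} (hx : ∀ k ∈ s, ExpDecay (x k)) :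
    ExpDecay fun n => ∑ k ∈ s, x k n := by
  classical
  induction s using Finset.induction_on with
  | empty => simpa using ExpDecay.zero
  | insert a s ha ih =>
    simp only [Finset.sum_insert ha]
    exact (hx a (Finset.mem_insert_self a s)).add
      (ih fun k hk => hx k (Finset.mem_insert_of_mem hk))

lemma ExpDecay.mul {x y : ℕ → ℂ} (hx : ExpDecay x) (hy : ExpDecay y) :
    ExpDecay fun n => x n * y n := by
  obtain ⟨C, ρ, hC, h0, h1, hb⟩ := hx
  obtain ⟨D, τ, hD, k0, k1, kb⟩ := hy
  refine ⟨C * D, ρ * τ, by positivity, by positivity,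
    mul_lt_one_of_nonneg_of_lt_one_left h0.le h1 k1.le, fun n => ?_⟩
  rw [norm_mul, mul_pow]
  calc ‖x n‖ * ‖y n‖ ≤ (C * ρ ^ n) * (D * τ ^ n) :=
        mul_le_mul (hb n) (kb n) (norm_nonneg _) (by positivity)
    _ = _ := by ring

lemma ExpDecay.conj {x : ℕ → ℂ} (hx : ExpDecay x) : ExpDecay fun n => conj (x n) := by
  obtain ⟨C, ρ, hC, h0, h1, hb⟩ := hx
  exact ⟨C, ρ, hC, h0, h1, fun n => by simpa using hb n⟩

lemma ExpDecay.summable_norm {x : ℕ → ℂ} (hx : ExpDecay x) : Summable fun n => ‖x n‖ := by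
  obtain ⟨C, ρ, hC, h0, h1, hb⟩ := hx
  exact Summable.of_nonneg_of_le (fun n => norm_nonneg _) hb
    ((summable_geometric_of_lt_one h0.le h1).mul_left C)

lemma ExpDecay.summable {x : ℕ → ℂ} (hx : ExpDecay x) : Summable x := hx.summable_norm.of_norm

/-- Controls the transient: with filters started at time 0, the covariance at time t is a partial
sum of the limiting series. -/
lemma ExpDecay.tail {x : ℕ → ℂ} (hx : ExpDecay x) :
    ExpDecay fun n => ∑ j ∈ Finset.range (n + 1), x j - ∑' j, x j := by
  have hs := hx.summable.hasSum
  obtain ⟨C, ρ, hC, h0, h1, hb⟩ := hx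
  have hd : 0 < 1 - ρ := sub_pos.2 h1
  refine ⟨C * ρ / (1 - ρ), ρ, by positivity, h0, h1, fun n => ?_⟩
  refine (norm_sub_le_of_geometric_bound_of_hasSum h1 hb hs (n + 1)).trans (le_of_eq ?_)
  ring

lemma ExpDecay.hasRate_average {x : ℕ → ℂ} (hx : ExpDecay x) :
    HasRate fun N => (1 / (N : ℂ)) * ∑ t ∈ Finset.Icc 1 N, x t := by
  refine hasRate_of_isBigO fun n => ?_
  have hs := hx.summable_norm
  have h1 : (fun N : ℕ => (1 / (N : ℂ)) * ∑ t ∈ Finset.Icc 1 N, x t) =O[atTop]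
      fun N : ℕ => (N : ℝ) ^ (-1 : ℝ) := by
    refine Asymptotics.IsBigO.of_bound (∑' t, ‖x t‖) (Eventually.of_forall fun N => ?_)
    rw [norm_mul, Real.rpow_neg_one, mul_comm]
    refine mul_le_mul ?_ (by simp) (norm_nonneg _) (tsum_nonneg fun _ => norm_nonneg _)
    exact (norm_sum_le _ _).trans (hs.sum_le_tsum _ fun _ _ => norm_nonneg _)
  refine h1.trans (isLittleO_rpow_rpow ?_).isBigO
  have : (0 : ℝ) < 1 / (n + 1) := by positivity
  linarith

/-! ### Filtered white noise -/

section Filtered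

variable {ι : Type*} [Fintype ι]

/-- The output of a causal filter with impulse response `α`, driven by `v`. -/
def filtered {Ω : Type*} (α : ℕ → ι → ℂ) (v : ℕ → Ω → ι → ℂ) (t : ℕ) (ω : Ω) : ℂ :=
  ∑ j ∈ Finset.range (t + 1), ∑ i, α j i * v (t - j) ω i

/-- Cross covariance at time `t` of two filtered white noises. -/
def crossCov (α β : ℕ → ι → ℂ) (t : ℕ) : ℂ :=
  ∑ j ∈ Finset.range (t + 1), ∑ i, α j i * conj (β j i)

/-- Limiting cross covariance of two filtered white noises. -/
def limCov (α β : ℕ → ι → ℂ) : ℂ := ∑' j, ∑ i, α j i * conj (β j i)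

lemma sum_range_product_eq {t B : ℕ} (h : t < B) (f : ℕ × ι → ℂ) :
    ∑ x ∈ Finset.range B ×ˢ Finset.univ, (if x.1 ≤ t then f x else 0) =
      ∑ j ∈ Finset.range (t + 1), ∑ i, f (j, i) := by
  rw [Finset.sum_product, ← Finset.sum_subset (Finset.range_mono (Nat.succ_le_of_lt h))]
  · refine Finset.sum_congr rfl fun j hj => Finset.sum_congr rfl fun i _ => ?_
    rw [if_pos (by have := Finset.mem_range.1 hj; omega)]
  · intro j _ hj
    refine Finset.sum_eq_zero fun i _ => ?_
    rw [if_neg (by have := Finset.mem_range.not.1 hj; omega)]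

/-- A range of lags not depending on t lets the sums over lags and over times be exchanged. -/
lemma filtered_eq {Ω : Type*} {α : ℕ → ι → ℂ} {v : ℕ → Ω → ι → ℂ} {t B : ℕ} (h : t < B) (ω : Ω) :
    filtered α v t ω =
      ∑ x ∈ Finset.range B ×ˢ Finset.univ, α x.1 x.2 * lag v t x ω := by
  simp only [lag, mul_ite, mul_zero]
  rw [sum_range_product_eq h fun x => α x.1 x.2 * v (t - x.1) ω x.2]
  rfl

lemma exists_weight_bound {α : ℕ → ι → ℂ} (hα : ∀ i, ExpDecay fun j => α j i) :
    ∃ A, 0 ≤ A ∧ ∀ B, ∑ x ∈ Finset.range B ×ˢ Finset.univ, ‖α x.1 x.2‖ ≤ A := by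
  refine ⟨∑ i, ∑' j, ‖α j i‖, by positivity, fun B => ?_⟩
  rw [Finset.sum_product_right]
  exact Finset.sum_le_sum fun i _ =>
    (hα i).summable_norm.sum_le_tsum _ fun _ _ => norm_nonneg _

/-- Weighted Cauchy–Schwarz inequality. -/
lemma norm_sum_mul_sq_le {κ : Type*} (S : Finset κ) (c z : κ → ℂ) :
    ‖∑ k ∈ S, c k * z k‖ ^ 2 ≤ (∑ k ∈ S, ‖c k‖) * ∑ k ∈ S, ‖c k‖ * ‖z k‖ ^ 2 := by
  refine (pow_le_pow_left₀ (norm_nonneg _) (norm_sum_le _ _) 2).trans ?_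
  refine Finset.sum_sq_le_sum_mul_sum_of_sq_le_mul S (fun _ _ => norm_nonneg _)
    (fun _ _ => by positivity) fun k _ => le_of_eq ?_
  rw [norm_mul]
  ring

/-- No relation between different k is assumed; an ℓ¹ bound on the weights is enough, so
interactions between different lag pairs never have to be computed. -/
lemma integral_norm_sq_sum_mul_le {Ω κ : Type*} [MeasurableSpace Ω] {P : Measure Ω}
    (S : Finset κ) (c : κ → ℂ) {Z : κ → Ω → ℂ} {D : ℝ} (hZ : ∀ k, MemLp (Z k) 2 P)
    (hD : ∀ k, ∫ ω, ‖Z k ω‖ ^ 2 ∂P ≤ D) :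
    ∫ ω, ‖∑ k ∈ S, c k * Z k ω‖ ^ 2 ∂P ≤ (∑ k ∈ S, ‖c k‖) ^ 2 * D := by
  have hi : ∀ k, Integrable (fun ω => ‖Z k ω‖ ^ 2) P := fun k =>
    (hZ k).integrable_norm_pow (p := 2) (by norm_num)
  calc ∫ ω, ‖∑ k ∈ S, c k * Z k ω‖ ^ 2 ∂P
      ≤ ∫ ω, (∑ k ∈ S, ‖c k‖) * ∑ k ∈ S, ‖c k‖ * ‖Z k ω‖ ^ 2 ∂P := by
        refine integral_mono ?_ ?_ fun ω => norm_sum_mul_sq_le S c fun k => Z k ω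
        · exact (memLp_finsetSum _ fun k _ => (hZ k).const_mul (c k)).integrable_norm_pow (p := 2)
            (by norm_num)
        · exact (integrable_finsetSum _ fun k _ => (hi k).const_mul _).const_mul _
    _ = (∑ k ∈ S, ‖c k‖) * ∑ k ∈ S, ‖c k‖ * ∫ ω, ‖Z k ω‖ ^ 2 ∂P := by
        rw [integral_const_mul, integral_finsetSum _ fun k _ => (hi k).const_mul _]
        simp only [integral_const_mul]
    _ ≤ (∑ k ∈ S, ‖c k‖) * ∑ k ∈ S, ‖c k‖ * D := by
        gcongr with k hk
        exact hD k
    _ = _ := by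
        rw [← Finset.sum_mul]
        ring

lemma expDecay_cov {α β : ℕ → ι → ℂ} (hα : ∀ i, ExpDecay fun j => α j i)
    (hβ : ∀ i, ExpDecay fun j => β j i) :
    ExpDecay fun j => ∑ i, α j i * conj (β j i) :=
  ExpDecay.sum _ fun i _ => (hα i).mul (hβ i).conj

variable [DecidableEq ι]

/-- Bilinear expansion over pairs of lags. The centring constants add up to `crossCov`, since only
equal pairs with lag at most t have nonzero mean. -/
lemma filtered_mul_sub_eq {Ω : Type*} (α β : ℕ → ι → ℂ) (v : ℕ → Ω → ι → ℂ) {t B : ℕ} (h : t < B)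
    (ω : Ω) :
    filtered α v t ω * conj (filtered β v t ω) - crossCov α β t =
      ∑ z ∈ (Finset.range B ×ˢ (Finset.univ : Finset ι)) ×ˢ (Finset.range B ×ˢ Finset.univ),
        (α z.1.1 z.1.2 * conj (β z.2.1 z.2.2)) * lagProd v z.1 z.2 t ω := by
  set I : Finset (ℕ × ι) := Finset.range B ×ˢ Finset.univ with hI
  have h1 : crossCov α β t = ∑ x ∈ I, ∑ y ∈ I, (α x.1 x.2 * conj (β y.1 y.2)) *
      if x = y ∧ x.1 ≤ t then 1 else 0 := by
    rw [crossCov, ← sum_range_product_eq h fun x => α x.1 x.2 * conj (β x.1 x.2)]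
    refine Finset.sum_congr rfl fun x hx => ?_
    rw [Finset.sum_eq_single x]
    · simp
    · intro y _ hy
      rw [if_neg (fun h => hy h.1.symm), mul_zero]
    · exact fun h => absurd hx h
  have h2 : ∀ γ : ℕ → ι → ℂ, filtered γ v t ω = ∑ x ∈ I, γ x.1 x.2 * lag v t x ω :=
    fun γ => filtered_eq h ω
  rw [h2, h2, map_sum, Finset.sum_mul_sum, h1, ← Finset.sum_sub_distrib,
    Finset.sum_product I I]
  refine Finset.sum_congr rfl fun x _ => ?_
  rw [← Finset.sum_sub_distrib]
  refine Finset.sum_congr rfl fun y _ => ?_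
  rw [lagProd, map_mul]
  ring

variable {Ω : Type*} [MeasurableSpace Ω] {P : Measure Ω} [IsProbabilityMeasure P]
  {v : ℕ → Ω → ι → ℂ} {K : ℝ} {α β : ℕ → ι → ℂ}

lemma IsWhite.memLp_filtered_mul_sub (hv : IsWhite P v K) (t : ℕ) :
    MemLp (fun ω => filtered α v t ω * conj (filtered β v t ω) - crossCov α β t) 2 P := by
  simp only [filtered_mul_sub_eq α β v t.lt_succ_self]
  exact memLp_finsetSum _ fun z _ => (hv.memLp_lagProd z.1 z.2 t).const_mul _

lemma IsWhite.integrable_filtered_mul (hv : IsWhite P v K) (t : ℕ) :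
    Integrable (fun ω => filtered α v t ω * conj (filtered β v t ω)) P := by
  have h := ((hv.memLp_filtered_mul_sub (α := α) (β := β) t).integrable (by norm_num)).add
    (integrable_const (crossCov α β t))
  refine h.congr (Eventually.of_forall fun ω => ?_)
  simp

lemma IsWhite.integral_filtered_mul (hv : IsWhite P v K) (t : ℕ) :
    ∫ ω, filtered α v t ω * conj (filtered β v t ω) ∂P = crossCov α β t := by
  have h : ∫ ω, (filtered α v t ω * conj (filtered β v t ω) - crossCov α β t) ∂P = 0 := by
    simp only [filtered_mul_sub_eq α β v t.lt_succ_self]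
    rw [integral_finsetSum _ fun z _ =>
      ((hv.memLp_lagProd z.1 z.2 t).integrable (by norm_num)).const_mul _]
    refine Finset.sum_eq_zero fun z _ => ?_
    rw [integral_const_mul, hv.integral_lagProd, mul_zero]
  rw [integral_sub (hv.integrable_filtered_mul t) (integrable_const _)] at h
  simpa [sub_eq_zero] using h

/-- Times are summed first: for a fixed pair of lags orthogonality gives growth linear in the number
of times. The ℓ¹ weights then combine the pairs with a constant not depending on S. -/
lemma IsWhite.integral_norm_sq_sum_filtered_le (hv : IsWhite P v K) {A A' : ℝ} (hA0 : 0 ≤ A)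
    (hA : ∀ B, ∑ x ∈ Finset.range B ×ˢ Finset.univ, ‖α x.1 x.2‖ ≤ A)
    (hA' : ∀ B, ∑ x ∈ Finset.range B ×ˢ Finset.univ, ‖β x.1 x.2‖ ≤ A') (S : Finset ℕ) :
    ∫ ω, ‖∑ t ∈ S, (filtered α v t ω * conj (filtered β v t ω) - crossCov α β t)‖ ^ 2 ∂P ≤
      (A * A') ^ 2 * (2 * K + 2) * S.card := by
  obtain ⟨B, hB⟩ : ∃ B, ∀ t ∈ S, t < B :=
    ⟨S.sup id + 1, fun t ht => Nat.lt_succ_of_le (Finset.le_sup (f := id) ht)⟩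
  set I : Finset (ℕ × ι) := Finset.range B ×ˢ Finset.univ with hI
  set c : (ℕ × ι) × (ℕ × ι) → ℂ := fun z => α z.1.1 z.1.2 * conj (β z.2.1 z.2.2) with hc
  have hK := hv.nonneg
  have hcA : ∑ z ∈ I ×ˢ I, ‖c z‖ ≤ A * A' := by
    have : ∑ z ∈ I ×ˢ I, ‖c z‖ = (∑ x ∈ I, ‖α x.1 x.2‖) * ∑ y ∈ I, ‖β y.1 y.2‖ := by
      rw [Finset.sum_product, Finset.sum_mul_sum]
      simp [hc]
    rw [this]
    exact mul_le_mul (hA B) (hA' B) (by positivity) hA0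
  have hc0 : 0 ≤ ∑ z ∈ I ×ˢ I, ‖c z‖ := by positivity
  have hsum : ∀ ω, ∑ t ∈ S, (filtered α v t ω * conj (filtered β v t ω) - crossCov α β t) =
      ∑ z ∈ I ×ˢ I, c z * ∑ t ∈ S, lagProd v z.1 z.2 t ω := by
    intro ω
    rw [Finset.sum_congr rfl fun t ht => filtered_mul_sub_eq α β v (hB t ht) ω, Finset.sum_comm]
    refine Finset.sum_congr rfl fun z _ => ?_
    rw [Finset.mul_sum]
  have hL : ∀ z : (ℕ × ι) × (ℕ × ι),
      ∫ ω, ‖∑ t ∈ S, lagProd v z.1 z.2 t ω‖ ^ 2 ∂P ≤ S.card * (2 * K + 2) := fun z =>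
    integral_norm_sq_sum_le (fun t => hv.memLp_lagProd z.1 z.2 t)
      (fun s t hst => hv.lagProd_orthogonal z.1 z.2 hst)
      (fun t => hv.integral_lagProd_sq_le z.1 z.2 t) S
  simp only [hsum]
  refine (integral_norm_sq_sum_mul_le (I ×ˢ I) c
    (fun z => memLp_finsetSum S fun t _ => hv.memLp_lagProd z.1 z.2 t) hL).trans ?_
  calc (∑ z ∈ I ×ˢ I, ‖c z‖) ^ 2 * (S.card * (2 * K + 2))
      ≤ (A * A') ^ 2 * (S.card * (2 * K + 2)) := by gcongr
    _ = _ := by ring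

/-- Limit expectation of a product of filtered white noises. -/
lemma IsWhite.hasLimitExpectation_filtered (hv : IsWhite P v K)
    (hα : ∀ i, ExpDecay fun j => α j i) (hβ : ∀ i, ExpDecay fun j => β j i) :
    HasLimitExpectation P (fun t ω => filtered α v t ω * conj (filtered β v t ω))
      (limCov α β) := by
  refine ⟨fun t => hv.integrable_filtered_mul t, ?_⟩
  simp only [hv.integral_filtered_mul]
  exact ((expDecay_cov hα hβ).summable.hasSum.tendsto_sum_nat).comp (tendsto_add_atTop_nat 1)

/-- Time averages of products of filtered white noises converge almost surely to their limit
expectations, with the rate `N ^ (-1/2 + δ)`. -/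
lemma IsWhite.ae_hasRate_filtered (hv : IsWhite P v K)
    (hα : ∀ i, ExpDecay fun j => α j i) (hβ : ∀ i, ExpDecay fun j => β j i) :
    ∀ᵐ ω ∂P, HasRate fun N => (1 / (N : ℂ)) *
      ∑ t ∈ Finset.Icc 1 N, filtered α v t ω * conj (filtered β v t ω) - limCov α β := by
  obtain ⟨A, hA0, hA⟩ := exists_weight_bound hα
  obtain ⟨A', -, hA'⟩ := exists_weight_bound hβ
  have h1 := ae_hasRate_average (P := P) (C := (A * A') ^ 2 * (2 * K + 2))
    (fun t => hv.memLp_filtered_mul_sub (α := α) (β := β) t) (fun a n => by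
      have h := hv.integral_norm_sq_sum_filtered_le (α := α) (β := β) hA0 hA hA'
        ((Finset.range n).map (addLeftEmbedding a))
      simpa using h)
  filter_upwards [h1] with ω hω
  -- The random fluctuation around `crossCov` and the deterministic transient together make up the
  -- deviation from the limit.
  have h2 := hω.add (expDecay_cov hα hβ).tail.hasRate_average
  intro δ hδ
  refine (h2 δ hδ).congr' ?_ EventuallyEq.rfl
  filter_upwards [eventually_gt_atTop 0] with N hN
  have hN0 : (N : ℂ) ≠ 0 := by exact_mod_cast hN.ne'
  rw [← mul_add, ← Finset.sum_add_distrib]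
  have h3 : ∀ t, filtered α v t ω * conj (filtered β v t ω) - crossCov α β t +
      (∑ j ∈ Finset.range (t + 1), ∑ i, α j i * conj (β j i) -
        ∑' j, ∑ i, α j i * conj (β j i)) =
      filtered α v t ω * conj (filtered β v t ω) - limCov α β := by
    intro t
    rw [crossCov, limCov]
    ring
  simp only [h3]
  rw [Finset.sum_sub_distrib]
  simp only [Finset.sum_const, Nat.card_Icc, Nat.add_sub_cancel, nsmul_eq_mul]
  field_simp

end Filtered

end OBF

end

/-! ### Abstract least squares and its normal equations. -/

noncomputable section

namespace OBF

open scoped Matrix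

/-! ### Quadratic cost functions -/

section Quadratic

variable {κ : Type*} [Fintype κ]

/-- A quadratic function with linear part `b` and Gram matrix `Γ`. -/
def lsQuad (s : ℂ) (b : κ → ℂ) (Γ : Matrix κ κ ℂ) (θ : κ → ℂ) : ℂ :=
  s - 2 * (star θ ⬝ᵥ b) + star θ ⬝ᵥ (Γ *ᵥ θ)

lemma lsQuad_eq_sum (s : ℂ) (b : κ → ℂ) (Γ : Matrix κ κ ℂ) (θ : κ → ℂ) :
    lsQuad s b Γ θ = s - ∑ k, 2 * conj (θ k) * b k + ∑ k, ∑ l, conj (θ k) * θ l * Γ k l := by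
  simp only [lsQuad, dotProduct, Matrix.mulVec, Finset.mul_sum, Pi.star_apply]
  refine congrArg₂ (· + ·) (congrArg₂ (· - ·) rfl (Finset.sum_congr rfl fun k _ => ?_))
    (Finset.sum_congr rfl fun k _ => Finset.sum_congr rfl fun l _ => ?_)
  · exact (mul_assoc _ _ _).symm
  · change conj (θ k) * _ = _
    ring

/-- Completing the square at a solution of the normal equations. Real parts are taken because
`lsQuad` doubles one cross term instead of adding its conjugate. -/
lemma re_lsQuad_eq {s : ℂ} {b : κ → ℂ} {Γ : Matrix κ κ ℂ} (hΓ : Γ.IsHermitian) {θ₀ : κ → ℂ}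
    (h0 : Γ *ᵥ θ₀ = b) (θ : κ → ℂ) :
    (lsQuad s b Γ θ).re = (lsQuad s b Γ θ₀).re + (star (θ - θ₀) ⬝ᵥ (Γ *ᵥ (θ - θ₀))).re := by
  obtain ⟨d, rfl⟩ : ∃ d, θ = θ₀ + d := ⟨θ - θ₀, by simp⟩
  have h1 : star θ₀ ⬝ᵥ (Γ *ᵥ d) = conj (star d ⬝ᵥ (Γ *ᵥ θ₀)) := by
    rw [starRingEnd_apply, Matrix.star_dotProduct, Matrix.star_mulVec, hΓ.eq,
      ← Matrix.dotProduct_mulVec]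
  have h2 : (star θ₀ ⬝ᵥ (Γ *ᵥ d)).re = (star d ⬝ᵥ (Γ *ᵥ θ₀)).re := by rw [h1, Complex.conj_re]
  simp only [lsQuad, ← h0, add_sub_cancel_left, star_add, Matrix.mulVec_add, add_dotProduct,
    dotProduct_add, Complex.add_re, Complex.sub_re, mul_add, h2]
  simp only [Complex.mul_re, Complex.re_ofNat, Complex.im_ofNat]
  ring

/-- A positive definite least-squares problem with several rows has a unique minimizer. -/
lemma sum_re_lsQuad_lt {p : ℕ} {s : Fin p → ℂ} {b : Fin p → κ → ℂ} {Γ : Matrix κ κ ℂ}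
    (hΓ : Γ.PosDef) {θ₀ θ : Fin p → κ → ℂ} (h0 : ∀ i, Γ *ᵥ θ₀ i = b i) (hθ : θ ≠ θ₀) :
    ∑ i, (lsQuad (s i) (b i) Γ (θ₀ i)).re < ∑ i, (lsQuad (s i) (b i) Γ (θ i)).re := by
  obtain ⟨i, hi⟩ := Function.ne_iff.1 hθ
  refine Finset.sum_lt_sum (fun i _ => ?_) ⟨i, Finset.mem_univ i, ?_⟩
  · rw [re_lsQuad_eq hΓ.isHermitian (h0 i) (θ i)]
    exact le_add_of_nonneg_right (hΓ.posSemidef.re_dotProduct_nonneg (θ i - θ₀ i))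
  · rw [re_lsQuad_eq hΓ.isHermitian (h0 i) (θ i)]
    exact lt_add_of_pos_right _ (hΓ.re_dotProduct_pos (sub_ne_zero.2 hi))

/-- The squared residual is a quadratic function of the parameter. -/
lemma norm_sub_sq_eq_lsQuad (y : ℂ) (φ θ : κ → ℂ) :
    ‖y - ∑ k, θ k * φ k‖ ^ 2 = (lsQuad (y * conj y) (fun k => y * conj (φ k))
      (Matrix.of fun k l => φ l * conj (φ k)) θ).re := by
  set a := ∑ k, θ k * φ k with ha
  have h1 : lsQuad (y * conj y) (fun k => y * conj (φ k))
      (Matrix.of fun k l => φ l * conj (φ k)) θ =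
      y * conj y - 2 * (y * conj a) + a * conj a := by
    rw [lsQuad_eq_sum, ha, map_sum, Finset.sum_mul_sum, Finset.mul_sum, Finset.mul_sum,
      Finset.sum_comm]
    refine congrArg₂ (· + ·) (congrArg₂ (· - ·) rfl (Finset.sum_congr rfl fun k _ => ?_))
      (Finset.sum_congr rfl fun k _ => Finset.sum_congr rfl fun l _ => ?_)
    · rw [map_mul]; ring
    · rw [map_mul, Matrix.of_apply]; ring
  rw [h1, ← Complex.normSq_eq_norm_sq, Complex.normSq_apply]
  simp [Complex.add_re, Complex.sub_re, Complex.mul_re]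
  ring

end Quadratic

/-! ### Sample averages -/

section Sample

/-- Time average over `1, …, N`. -/
def average (x : ℕ → ℂ) (N : ℕ) : ℂ := (1 / (N : ℂ)) * ∑ t ∈ Finset.Icc 1 N, x t

variable {κ : Type*}

/-- The Gram matrix of `N` samples of a regressor. -/
def sampleGram (φ : ℕ → κ → ℂ) (N : ℕ) : Matrix κ κ ℂ :=
  Matrix.of fun k l => average (fun t => φ t l * conj (φ t k)) N

/-- The correlation of a signal with a regressor over `N` samples. -/
def sampleCorr (y : ℕ → ℂ) (φ : ℕ → κ → ℂ) (N : ℕ) : κ → ℂ :=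
  fun k => average (fun t => y t * conj (φ t k)) N

variable [Fintype κ]

lemma sampleGram_posSemidef (φ : ℕ → κ → ℂ) (N : ℕ) : (sampleGram φ N).PosSemidef := by
  have h : sampleGram φ N = (1 / (N : ℂ)) •
      ∑ t ∈ Finset.Icc 1 N, Matrix.vecMulVec (star (φ t)) (φ t) := by
    ext k l
    simp only [sampleGram, average, Matrix.of_apply, Matrix.smul_apply, Matrix.sum_apply,
      Matrix.vecMulVec_apply, smul_eq_mul, Pi.star_apply]
    refine congrArg _ (Finset.sum_congr rfl fun t _ => ?_)
    rw [mul_comm]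
    rfl
  rw [h]
  refine Matrix.PosSemidef.smul (Matrix.posSemidef_sum _ fun t _ => ?_) (by positivity)
  exact Matrix.posSemidef_vecMulVec_star_self _

/-- For fixed θ the quadratic is linear in its data (s, b, Γ), so averaging passes to the data. -/
lemma average_norm_sub_sq (y : ℕ → ℂ) (φ : ℕ → κ → ℂ) (θ : κ → ℂ) (N : ℕ) :
    (1 / (N : ℝ)) * ∑ t ∈ Finset.Icc 1 N, ‖y t - ∑ k, θ k * φ t k‖ ^ 2 =
      (lsQuad (average (fun t => y t * conj (y t)) N) (sampleCorr y φ N) (sampleGram φ N) θ).re := by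
  have h1 : lsQuad (average (fun t => y t * conj (y t)) N) (sampleCorr y φ N) (sampleGram φ N) θ =
      average (fun t => lsQuad (y t * conj (y t)) (fun k => y t * conj (φ t k))
        (Matrix.of fun k l => φ t l * conj (φ t k)) θ) N := by
    simp only [lsQuad_eq_sum, average, sampleCorr, sampleGram, Matrix.of_apply,
      Finset.sum_add_distrib, Finset.sum_sub_distrib, mul_add, mul_sub, Finset.mul_sum]
    refine congrArg₂ (· + ·) (congrArg₂ (· - ·) rfl ?_) ?_
    · rw [Finset.sum_comm]
      refine Finset.sum_congr rfl fun k _ => Finset.sum_congr rfl fun l _ => ?_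
      ring
    · refine Eq.trans (Finset.sum_congr rfl fun k _ => ?_) Finset.sum_comm
      refine Eq.trans ?_ Finset.sum_comm
      refine Finset.sum_congr rfl fun l _ => Finset.sum_congr rfl fun t _ => ?_
      ring
  rw [h1, average]
  have h2 : (1 / (N : ℂ)) = ((1 / (N : ℝ) : ℝ) : ℂ) := by push_cast; rfl
  rw [h2, Complex.re_ofReal_mul, Complex.re_sum]
  simp only [norm_sub_sq_eq_lsQuad]

variable [DecidableEq κ]

/-- Convergence of solutions of the normal equations, with a rate. -/
lemma hasRate_normal_equations {Γ : Matrix κ κ ℂ} (hΓ : IsUnit Γ.det) {ΓN : ℕ → Matrix κ κ ℂ}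
    {b : κ → ℂ} {bN : ℕ → κ → ℂ}
    (hΓN : ∀ k l, HasRate fun N => ΓN N k l - Γ k l) (hbN : ∀ k, HasRate fun N => bN N k - b k) :
    (∀ᶠ N in atTop, IsUnit (ΓN N).det) ∧
      ∀ k, HasRate fun N => ((ΓN N)⁻¹ *ᵥ bN N) k - (Γ⁻¹ *ᵥ b) k := by
  have ht : Tendsto ΓN atTop (𝓝 Γ) := by
    refine tendsto_pi_nhds.2 fun k => tendsto_pi_nhds.2 fun l => ?_
    exact tendsto_sub_nhds_zero_iff.1 (hΓN k l).tendsto_zero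
  have hdet : Tendsto (fun N => (ΓN N).det) atTop (𝓝 Γ.det) :=
    ((Continuous.matrix_det continuous_id).tendsto Γ).comp ht
  have hev : ∀ᶠ N in atTop, IsUnit (ΓN N).det := by
    filter_upwards [hdet.eventually_ne hΓ.ne_zero] with N hN
    exact isUnit_iff_ne_zero.2 hN
  refine ⟨hev, ?_⟩
  have hinv : Tendsto (fun N => (ΓN N)⁻¹) atTop (𝓝 Γ⁻¹) := by
    simp only [Matrix.inv_def, Ring.inverse_eq_inv']
    exact (hdet.inv₀ hΓ.ne_zero).smul
      (((Continuous.matrix_adjugate continuous_id).tendsto Γ).comp ht)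
  set θ := Γ⁻¹ *ᵥ b with hθ
  have hΓθ : Γ *ᵥ θ = b := by
    rw [hθ, Matrix.mulVec_mulVec, Matrix.mul_nonsing_inv _ hΓ, Matrix.one_mulVec]
  -- As Γ θ = b, the residual of θ in the sampled equations is (bN - b) - (ΓN - Γ) θ, which has the
  -- rate. The inverses of ΓN converge and hence stay bounded, so applying them preserves the rate.
  have hres : ∀ k, HasRate fun N => (bN N - ΓN N *ᵥ θ) k := by
    intro k
    have h1 := (hbN k).sub (HasRate.sum (s := Finset.univ) fun l _ => (hΓN k l).const_mul (θ l))
    have h2 : ∀ N, (bN N - ΓN N *ᵥ θ) k =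
        bN N k - b k - ∑ l, θ l * (ΓN N k l - Γ k l) := by
      intro N
      rw [Pi.sub_apply, ← hΓθ]
      simp only [Matrix.mulVec, dotProduct, mul_sub, Finset.sum_sub_distrib]
      simp only [mul_comm (θ _)]
      ring
    simpa only [h2] using h1
  intro k
  have h1 : HasRate fun N => ∑ l, (ΓN N)⁻¹ k l * (bN N - ΓN N *ᵥ θ) l := by
    refine HasRate.sum fun l _ => (hres l).bdd_mul ?_
    exact ((tendsto_pi_nhds.1 (tendsto_pi_nhds.1 hinv k) l)).isBigO_one ℝ
  intro δ hδ
  refine (h1 δ hδ).congr' ?_ EventuallyEq.rfl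
  filter_upwards [hev] with N hN
  have h2 : (ΓN N)⁻¹ *ᵥ bN N - θ = (ΓN N)⁻¹ *ᵥ (bN N - ΓN N *ᵥ θ) := by
    rw [Matrix.mulVec_sub, Matrix.mulVec_mulVec, Matrix.nonsing_inv_mul _ hN, Matrix.one_mulVec]
  exact (congrFun h2 k).symm

end Sample

/-! ### Limit expectations -/

section Limit

variable {Ω : Type*} [MeasurableSpace Ω] {P : Measure Ω}

lemma HasLimitExpectation.add {X Y : ℕ → Ω → ℂ} {L M : ℂ} (hX : HasLimitExpectation P X L)
    (hY : HasLimitExpectation P Y M) : HasLimitExpectation P (fun t ω => X t ω + Y t ω) (L + M) := by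
  refine ⟨fun t => (hX.1 t).add (hY.1 t), ?_⟩
  simp only [fun t => integral_add (hX.1 t) (hY.1 t)]
  exact hX.2.add hY.2

lemma HasLimitExpectation.const_mul {X : ℕ → Ω → ℂ} {L : ℂ} (c : ℂ)
    (hX : HasLimitExpectation P X L) : HasLimitExpectation P (fun t ω => c * X t ω) (c * L) := by
  refine ⟨fun t => (hX.1 t).const_mul c, ?_⟩
  simp only [integral_const_mul]
  exact hX.2.const_mul c

lemma HasLimitExpectation.sub {X Y : ℕ → Ω → ℂ} {L M : ℂ} (hX : HasLimitExpectation P X L)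
    (hY : HasLimitExpectation P Y M) : HasLimitExpectation P (fun t ω => X t ω - Y t ω) (L - M) := by
  refine ⟨fun t => (hX.1 t).sub (hY.1 t), ?_⟩
  simp only [fun t => integral_sub (hX.1 t) (hY.1 t)]
  exact hX.2.sub hY.2

lemma HasLimitExpectation.sum {E κ : Type*} [NormedAddCommGroup E] [NormedSpace ℝ E]
    {s : Finset κ} {X : κ → ℕ → Ω → E} {L : κ → E}
    (hX : ∀ k ∈ s, HasLimitExpectation P (X k) (L k)) :
    HasLimitExpectation P (fun t ω => ∑ k ∈ s, X k t ω) (∑ k ∈ s, L k) := by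
  refine ⟨fun t => integrable_finsetSum _ fun k hk => (hX k hk).1 t, ?_⟩
  have h : ∀ t, ∫ ω, ∑ k ∈ s, X k t ω ∂P = ∑ k ∈ s, ∫ ω, X k t ω ∂P := fun t =>
    integral_finsetSum _ fun k hk => (hX k hk).1 t
  simp only [h]
  exact tendsto_finsetSum _ fun k hk => (hX k hk).2

lemma HasLimitExpectation.re {X : ℕ → Ω → ℂ} {L : ℂ} (hX : HasLimitExpectation P X L) :
    HasLimitExpectation P (fun t ω => (X t ω).re) L.re := by
  refine ⟨fun t => (hX.1 t).re, ?_⟩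
  have h : ∀ t, ∫ ω, (X t ω).re ∂P = (∫ ω, X t ω ∂P).re := fun t => integral_re (hX.1 t)
  simp only [h]
  exact (Complex.continuous_re.tendsto L).comp hX.2

lemma HasLimitExpectation.lsQuad {κ : Type*} [Fintype κ] {s : ℕ → Ω → ℂ} {b : κ → ℕ → Ω → ℂ}
    {Γ : κ → κ → ℕ → Ω → ℂ} {s' : ℂ} {b' : κ → ℂ} {Γ' : Matrix κ κ ℂ}
    (hs : HasLimitExpectation P s s') (hb : ∀ k, HasLimitExpectation P (b k) (b' k))
    (hΓ : ∀ k l, HasLimitExpectation P (Γ k l) (Γ' k l)) (θ : κ → ℂ) :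
    HasLimitExpectation P
      (fun t ω => lsQuad (s t ω) (fun k => b k t ω) (Matrix.of fun k l => Γ k l t ω) θ)
      (lsQuad s' b' Γ' θ) := by
  simp only [lsQuad_eq_sum, Matrix.of_apply]
  exact (hs.sub (HasLimitExpectation.sum fun k _ => (hb k).const_mul _)).add
    (HasLimitExpectation.sum fun k _ => HasLimitExpectation.sum fun l _ => (hΓ k l).const_mul _)

/-- The limiting Gram matrix of linearly independent filters is positive definite. -/
lemma limCov_posDef {ι κ : Type*} [Fintype ι] [Fintype κ] {α : κ → ℕ → ι → ℂ}
    (hα : ∀ k i, ExpDecay fun j => α k j i)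
    (hli : ∀ x : κ → ℂ, (∀ j i, ∑ k, x k * α k j i = 0) → x = 0) :
    (Matrix.of fun k l => limCov (α l) (α k)).PosDef := by
  have hsum : ∀ k l, HasSum (fun j => ∑ i, α l j i * conj (α k j i)) (limCov (α l) (α k)) :=
    fun k l => (expDecay_cov (hα l) (hα k)).summable.hasSum
  refine Matrix.PosDef.of_dotProduct_mulVec_pos ?_ fun x hx => ?_
  · ext k l
    rw [Matrix.conjTranspose_apply, Matrix.of_apply, Matrix.of_apply, limCov, limCov,
      ← starRingEnd_apply, Complex.conj_tsum]
    refine tsum_congr fun j => ?_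
    rw [map_sum]
    refine Finset.sum_congr rfl fun i _ => ?_
    rw [map_mul, Complex.conj_conj, mul_comm]
  -- The quadratic form is the squared ℓ² norm of the impulse response of the combined filter, so it
  -- vanishes only if that filter does.
  · set f : ℕ → ℝ := fun j => ∑ i, ‖∑ k, x k * α k j i‖ ^ 2 with hf
    have h1 : HasSum (fun j => (f j : ℂ))
        (star x ⬝ᵥ ((Matrix.of fun k l => limCov (α l) (α k)) *ᵥ x)) := by
      have h2 := hasSum_sum (s := Finset.univ) fun k _ => hasSum_sum (s := Finset.univ) fun l _ =>
        (hsum k l).mul_left (conj (x k) * x l)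
      have e1 : ∀ j, (f j : ℂ) = ∑ k, ∑ l, conj (x k) * x l * ∑ i, α l j i * conj (α k j i) := by
        intro j
        simp only [hf, Complex.ofReal_sum, Complex.ofReal_pow, ← Complex.mul_conj', map_sum,
          map_mul, Finset.mul_sum, Finset.sum_mul]
        rw [Finset.sum_comm]
        refine Finset.sum_congr rfl fun l _ => ?_
        rw [Finset.sum_comm]
        refine Finset.sum_congr rfl fun k _ => Finset.sum_congr rfl fun i _ => ?_
        ring
      have e2 : star x ⬝ᵥ ((Matrix.of fun k l => limCov (α l) (α k)) *ᵥ x) =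
          ∑ k, ∑ l, conj (x k) * x l * limCov (α l) (α k) := by
        simp only [dotProduct, Matrix.mulVec, Finset.mul_sum, Matrix.of_apply, Pi.star_apply]
        refine Finset.sum_congr rfl fun k _ => Finset.sum_congr rfl fun l _ => ?_
        change conj (x k) * _ = _
        ring
      rw [e2]
      simpa only [e1] using h2
    have h3 : Summable f := Complex.summable_ofReal.1 h1.summable
    rw [← h1.tsum_eq, ← Complex.ofReal_tsum]
    have h4 : ∃ j, 0 < f j := by
      by_contra! h
      refine hx (hli x fun j i => ?_)
      have h5 : f j = 0 := le_antisymm (h j) (Finset.sum_nonneg fun i _ => sq_nonneg _)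
      have h6 := (Finset.sum_eq_zero_iff_of_nonneg fun i _ => sq_nonneg _).1 h5 i
        (Finset.mem_univ i)
      simpa using h6
    obtain ⟨j, hj⟩ := h4
    exact_mod_cast h3.tsum_pos (fun j => Finset.sum_nonneg fun i _ => sq_nonneg _) j hj

end Limit

end OBF

end

/-! ### Regression form of the model and its frequency response. -/

noncomputable section

namespace OBF

open scoped Matrix

/-! ### The model as a linear regression -/

section Model

variable {p m q : ℕ}

/-- The regressor: the inputs filtered by the fixed poles. -/
def regressor (μ : Fin q → ℂ) (u : ℕ → Fin m → ℂ) (t : ℕ) (x : Fin q × Fin m) : ℂ :=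
  ∑ j ∈ Finset.range (t + 1),
    impulse (1 / (RatFunc.X - RatFunc.C (μ x.1))) j * u (t - j) x.2

/-- The coefficients of a model, row by row. -/
def rows : (Fin q → Matrix (Fin p) (Fin m) ℂ) ≃ (Fin p → Fin q × Fin m → ℂ) where
  toFun R i x := R x.1 i x.2
  invFun θ k := Matrix.of fun i l => θ i (k, l)
  left_inv _ := rfl
  right_inv _ := rfl

lemma rows_apply (R : Fin q → Matrix (Fin p) (Fin m) ℂ) (i : Fin p) (k : Fin q) (l : Fin m) :
    rows R i (k, l) = R k i l := rfl

lemma model_apply (μ : Fin q → ℂ) (R : Fin q → Matrix (Fin p) (Fin m) ℂ) (i : Fin p) (l : Fin m) :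
    model μ R i l = ∑ k, 1 / (RatFunc.X - RatFunc.C (μ k)) * RatFunc.C (R k i l) := by
  simp [model, Matrix.sum_apply]

lemma impulse_model (μ : Fin q → ℂ) (R : Fin q → Matrix (Fin p) (Fin m) ℂ) (i : Fin p)
    (l : Fin m) (j : ℕ) :
    impulse (model μ R i l) j =
      ∑ k, R k i l * impulse (1 / (RatFunc.X - RatFunc.C (μ k))) j := by
  simp only [impulse_eq]
  rw [model_apply, map_sum, HahnSeries.coeff_sum]
  refine Finset.sum_congr rfl fun k _ => ?_
  rw [map_mul, laurentHom_C, mul_comm, HahnSeries.C_mul_eq_smul, HahnSeries.coeff_smul, smul_eq_mul]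

lemma applyTF_model (μ : Fin q → ℂ) (R : Fin q → Matrix (Fin p) (Fin m) ℂ) (u : ℕ → Fin m → ℂ)
    (t : ℕ) (i : Fin p) :
    applyTF (model μ R) u t i = ∑ x, rows R i x * regressor μ u t x := by
  rw [Fintype.sum_prod_type]
  simp only [applyTF, impulse_model, rows_apply, regressor, Finset.mul_sum,
    Finset.sum_mul]
  refine Eq.trans ?_ Finset.sum_comm
  refine Eq.trans Finset.sum_comm ?_
  refine Finset.sum_congr rfl fun l _ => ?_
  refine Eq.trans Finset.sum_comm ?_
  refine Finset.sum_congr rfl fun k _ => Finset.sum_congr rfl fun j _ => ?_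
  ring

lemma sqError_eq (μ : Fin q → ℂ) (y : ℕ → Fin p → ℂ) (u : ℕ → Fin m → ℂ)
    (R : Fin q → Matrix (Fin p) (Fin m) ℂ) (t : ℕ) :
    sqError μ y u R t = ∑ i, ‖y t i - ∑ x, rows R i x * regressor μ u t x‖ ^ 2 := by
  simp only [sqError, applyTF_model]

lemma lsCost_eq (μ : Fin q → ℂ) (y : ℕ → Fin p → ℂ) (u : ℕ → Fin m → ℂ) (N : ℕ)
    (R : Fin q → Matrix (Fin p) (Fin m) ℂ) :
    lsCost μ y u N R = ∑ i, (lsQuad (average (fun t => y t i * conj (y t i)) N)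
      (sampleCorr (fun t => y t i) (regressor μ u) N) (sampleGram (regressor μ u) N)
      (rows R i)).re := by
  simp only [lsCost, sqError_eq]
  rw [Finset.sum_comm, Finset.mul_sum]
  exact Finset.sum_congr rfl fun i _ => average_norm_sub_sq (fun t => y t i) _ _ _

/-- With a positive definite Gram matrix, the solution of the normal equations is the only solution
of the least-squares problem. -/
lemma isLSSolution_iff {μ : Fin q → ℂ} {y : ℕ → Fin p → ℂ} {u : ℕ → Fin m → ℂ} {N : ℕ}
    (h : IsUnit (sampleGram (regressor μ u) N).det) (R : Fin q → Matrix (Fin p) (Fin m) ℂ) :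
    IsLSSolution μ y u N R ↔ rows R = fun i => (sampleGram (regressor μ u) N)⁻¹ *ᵥ
      sampleCorr (fun t => y t i) (regressor μ u) N := by
  set Γ := sampleGram (regressor μ u) N with hΓ
  have hpd : Γ.PosDef :=
    (sampleGram_posSemidef _ N).posDef_iff_isUnit.2 ((Matrix.isUnit_iff_isUnit_det _).2 h)
  set θ₀ : Fin p → Fin q × Fin m → ℂ := fun i => Γ⁻¹ *ᵥ
      sampleCorr (fun t => y t i) (regressor μ u) N with hθ₀
  have h0 : ∀ i, Γ *ᵥ θ₀ i = sampleCorr (fun t => y t i) (regressor μ u) N := by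
    intro i
    rw [hθ₀, Matrix.mulVec_mulVec, Matrix.mul_nonsing_inv _ h, Matrix.one_mulVec]
  have hlt : ∀ R', rows R' ≠ θ₀ → lsCost μ y u N (rows.symm θ₀) < lsCost μ y u N R' := by
    intro R' hR'
    rw [lsCost_eq, lsCost_eq, Equiv.apply_symm_apply]
    exact sum_re_lsQuad_lt hpd h0 hR'
  constructor
  · intro hR
    by_contra hne
    exact absurd (hR (rows.symm θ₀)) (not_le.2 (hlt R hne))
  · intro hR R'
    rw [← Equiv.eq_symm_apply] at hR
    rw [hR]
    by_cases hR' : rows R' = θ₀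
    · rw [← Equiv.eq_symm_apply] at hR'
      rw [hR']
    · exact (hlt R' hR').le

/-! ### The `H₂` norm of a model -/

/-- `RatFunc.eval` is additive only where the reduced denominators do not vanish, so nonvanishing is
proved along with the value. -/
lemma eval_pole {a z : ℂ} (h : z ≠ a) (c : ℂ) :
    ((1 / (RatFunc.X - RatFunc.C a) * RatFunc.C c).denom.eval z ≠ 0) ∧
    (1 / (RatFunc.X - RatFunc.C a) * RatFunc.C c).eval (RingHom.id ℂ) z = c / (z - a) := by
  have hza : z - a ≠ 0 := sub_ne_zero.2 h
  have h1 : (1 / (RatFunc.X - RatFunc.C a) * RatFunc.C c : RatFunc ℂ) =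
      algebraMap _ _ (Polynomial.C c) / algebraMap _ _ (Polynomial.X - Polynomial.C a) := by
    rw [map_sub, RatFunc.algebraMap_X, RatFunc.algebraMap_C, RatFunc.algebraMap_C]
    ring
  set f : RatFunc ℂ := 1 / (RatFunc.X - RatFunc.C a) * RatFunc.C c with hf
  have hd : f.denom ∣ Polynomial.X - Polynomial.C a := by
    rw [h1]
    exact RatFunc.denom_div_dvd _ _
  have hdz : f.denom.eval z ≠ 0 := by
    intro h0
    have := Polynomial.eval_eq_zero_of_dvd_of_eval_eq_zero hd h0
    simp at this
    exact hza this
  refine ⟨hdz, ?_⟩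
  have h2 : f.num * (Polynomial.X - Polynomial.C a) = Polynomial.C c * f.denom := by
    have h3 := RatFunc.num_div_denom f
    nth_rw 3 [h1] at h3
    rw [div_eq_div_iff (RatFunc.algebraMap_ne_zero f.denom_ne_zero)
      (RatFunc.algebraMap_ne_zero (Polynomial.X_sub_C_ne_zero a)), ← map_mul, ← map_mul] at h3
    exact RatFunc.algebraMap_injective ℂ h3
  have h3 := congrArg (Polynomial.eval z) h2
  simp only [Polynomial.eval_mul, Polynomial.eval_sub, Polynomial.eval_X, Polynomial.eval_C] at h3
  rw [RatFunc.eval, Polynomial.eval₂_id, Polynomial.eval₂_id, div_eq_div_iff hdz hza, h3]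

lemma eval_sum_poles {μ : Fin q → ℂ} {z : ℂ} (h : ∀ k, z ≠ μ k) (c : Fin q → ℂ)
    (s : Finset (Fin q)) :
    (∑ k ∈ s, 1 / (RatFunc.X - RatFunc.C (μ k)) * RatFunc.C (c k)).denom.eval z ≠ 0 ∧
    (∑ k ∈ s, 1 / (RatFunc.X - RatFunc.C (μ k)) * RatFunc.C (c k)).eval (RingHom.id ℂ) z =
      ∑ k ∈ s, c k / (z - μ k) := by
  induction s using Finset.induction_on with
  | empty => simp
  | insert a s ha ih =>
    rw [Finset.sum_insert ha, Finset.sum_insert ha]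
    obtain ⟨h1, h2⟩ := eval_pole (h a) (c a)
    refine ⟨fun h0 => ?_, ?_⟩
    · have := Polynomial.eval_eq_zero_of_dvd_of_eval_eq_zero (RatFunc.denom_add_dvd _ _) h0
      rw [Polynomial.eval_mul] at this
      exact (mul_ne_zero h1 ih.1) this
    · rw [RatFunc.eval_add (RingHom.id ℂ) z (by rwa [Polynomial.eval₂_id])
        (by rw [Polynomial.eval₂_id]; exact ih.1), h2, ih.2]

/-- The `H₂` norm of the difference of two models is controlled by the coefficients. -/
lemma exists_h2Norm_le {μ : Fin q → ℂ} (hμ : ∀ k, ‖μ k‖ < 1) :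
    ∃ C, ∀ R R' : Fin q → Matrix (Fin p) (Fin m) ℂ,
      h2Norm (model μ R - model μ R') ≤ C * ∑ i, ∑ x, ‖rows R i x - rows R' i x‖ := by
  -- On the unit circle ‖z - μ k‖ ≥ 1 - ‖μ k‖, which bounds each entry of the difference by M times
  -- the coefficient distance.
  set M : ℝ := ∑ k, (1 - ‖μ k‖)⁻¹ with hM
  have hpos : ∀ k, 0 < 1 - ‖μ k‖ := fun k => sub_pos.2 (hμ k)
  have hM0 : 0 ≤ M := Finset.sum_nonneg fun k _ => (inv_pos.2 (hpos k)).le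
  refine ⟨Real.sqrt (p * m) * M, fun R R' => ?_⟩
  set D : ℝ := ∑ i, ∑ x, ‖rows R i x - rows R' i x‖ with hD
  have hD0 : 0 ≤ D := by positivity
  have hsub : ∀ i l, (model μ R - model μ R') i l =
      ∑ k, 1 / (RatFunc.X - RatFunc.C (μ k)) * RatFunc.C (R k i l - R' k i l) := by
    intro i l
    rw [Matrix.sub_apply, model_apply, model_apply, ← Finset.sum_sub_distrib]
    refine Finset.sum_congr rfl fun k _ => ?_
    rw [map_sub]
    ring
  have hentry : ∀ i l (θ : ℝ), ‖((model μ R - model μ R') i l).eval (RingHom.id ℂ)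
      (Complex.exp (θ * Complex.I))‖ ≤ M * D := by
    intro i l θ
    have hz : ‖Complex.exp (θ * Complex.I)‖ = 1 := Complex.norm_exp_ofReal_mul_I θ
    set z := Complex.exp (θ * Complex.I)
    have hne : ∀ k, z ≠ μ k := by
      intro k h
      have := hμ k
      rw [← h, hz] at this
      exact lt_irrefl _ this
    rw [hsub, (eval_sum_poles hne _ _).2, hM, Finset.sum_mul]
    refine (norm_sum_le _ _).trans (Finset.sum_le_sum fun k _ => ?_)
    have h1 : 1 - ‖μ k‖ ≤ ‖z - μ k‖ := by
      rw [← hz]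
      exact norm_sub_norm_le _ _
    have h2 : ‖R k i l - R' k i l‖ ≤ D := by
      have h3 : ‖rows R i (k, l) - rows R' i (k, l)‖ ≤ ∑ x, ‖rows R i x - rows R' i x‖ :=
        Finset.single_le_sum (f := fun x => ‖rows R i x - rows R' i x‖)
          (fun _ _ => norm_nonneg _) (Finset.mem_univ (k, l))
      refine h3.trans ?_
      exact Finset.single_le_sum (f := fun i => ∑ x, ‖rows R i x - rows R' i x‖)
        (fun _ _ => by positivity) (Finset.mem_univ i)
    rw [norm_div, div_eq_inv_mul]
    have := hpos k
    gcongr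
  have hint : ‖∫ θ in (0 : ℝ)..(2 * Real.pi), ∑ i, ∑ j,
      ‖((model μ R - model μ R') i j).eval (RingHom.id ℂ) (Complex.exp (θ * Complex.I))‖ ^ 2‖ ≤
      (p * m * (M * D) ^ 2) * |2 * Real.pi - 0| := by
    refine intervalIntegral.norm_integral_le_of_norm_le_const fun θ _ => ?_
    rw [Real.norm_of_nonneg (by positivity)]
    calc _ ≤ ∑ _i : Fin p, ∑ _j : Fin m, (M * D) ^ 2 := by
          gcongr with i _ j _
          exact hentry i j θ
      _ = _ := by
          simp
          ring
  have hpi : 0 < 2 * Real.pi := by positivity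
  rw [sub_zero, abs_of_pos hpi] at hint
  have h1 := (le_abs_self _).trans hint
  rw [h2Norm]
  calc _ ≤ Real.sqrt (p * m * (M * D) ^ 2) := by
        refine Real.sqrt_le_sqrt ?_
        rw [inv_mul_le_iff₀ hpi]
        linarith
    _ = Real.sqrt (p * m) * M * D := by
        rw [Real.sqrt_mul (by positivity), Real.sqrt_sq (by positivity)]
        ring

end Model

end OBF

end

/-! ### Noise representation of the signals and linear independence from excitation. -/

noncomputable section

namespace OBF

open scoped Matrix

/-! ### Signals as filtered noise -/

lemma sig_regressor {m q : ℕ} (μ : Fin q → ℂ) (u : ℕ → Fin m → ℂ) (x : Fin q × Fin m) :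
    sig (fun t => regressor μ u t x) =
      laurentHom (1 / (RatFunc.X - RatFunc.C (μ x.1))) * sigv u x.2 := by
  rw [← sig_impulse (pole_mem_causal _), sigv, ← sig_conv]
  rfl

lemma eq_filtered {Ω : Type*} {r s : ℕ} {e : ℕ → Ω → Fin r → ℂ} {ε : ℕ → Ω → Fin s → ℂ}
    {F : Fin r ⊕ Fin s → RatFunc ℂ} (hF : ∀ a, laurentHom (F a) ∈ causal) {x : ℕ → ℂ} {ω : Ω}
    (h : sig x = ∑ a, laurentHom (F a) * sig (fun t => joinNoise e ε t ω a)) (t : ℕ) :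
    x t = filtered (fun j a => impulse (F a) j) (joinNoise e ε) t ω := by
  have h1 : sig x = sig fun t => filtered (fun j a => impulse (F a) j) (joinNoise e ε) t ω := by
    rw [h]
    simp only [filtered]
    simp_rw [Finset.sum_comm (s := Finset.range _)]
    rw [sig_sum]
    refine Finset.sum_congr rfl fun a _ => ?_
    rw [sig_conv (impulse (F a)) (fun t => joinNoise e ε t ω a), sig_impulse (hF a)]
  exact congrFun (sig_injective h1) t

lemma sum_sumElim_mul_sig {Ω : Type*} {r s : ℕ} (e : ℕ → Ω → Fin r → ℂ) (ε : ℕ → Ω → Fin s → ℂ)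
    (ω : Ω) (f : Fin r → RatFunc ℂ) (g : Fin s → RatFunc ℂ) :
    ∑ a, laurentHom (Sum.elim f g a) * sig (fun t => joinNoise e ε t ω a) =
      ∑ k, laurentHom (f k) * sigv (fun τ => e τ ω) k +
        ∑ k, laurentHom (g k) * sigv (fun τ => ε τ ω) k := by
  rw [Fintype.sum_sum_type]
  rfl

/-! ### Persistent excitation -/

/-- Multiplication by zⁱ is the forward shift, so L acts as a difference operator on n consecutive
samples. Coefficients of negative index, which carry initial values, are not concerned. -/
lemma coeff_polyLaurent_mul_sig {L : Polynomial ℂ} {n : ℕ} (hL : L.natDegree < n) (w : ℕ → ℂ)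
    (t : ℕ) : (polyLaurent L * sig w).coeff (t : ℤ) = ∑ i : Fin n, L.coeff i * w (t + i) := by
  have h1 : polyLaurent L = ∑ i ∈ Finset.range n, HahnSeries.single (-(i : ℤ)) (L.coeff i) := by
    rw [polyLaurent_apply]
    refine Finset.sum_subset (fun i hi => ?_) fun i _ hi => ?_
    · exact Finset.mem_range.2 ((Polynomial.le_natDegree_of_mem_supp i hi).trans_lt hL)
    · rw [Polynomial.notMem_support_iff.1 hi, map_zero]
  rw [h1, Finset.sum_mul, HahnSeries.coeff_sum, Finset.sum_range]
  refine Finset.sum_congr rfl fun i _ => ?_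
  rw [HahnSeries.coeff_single_mul, ← coeff_sig w]
  congr 2
  push_cast
  ring

/-- A persistently exciting signal satisfies no linear difference equation of low order. -/
lemma IsPersistentlyExciting.eq_zero {Ω : Type*} [MeasurableSpace Ω] {P : Measure Ω} {m n : ℕ}
    {w : ℕ → Ω → Fin m → ℂ} (hw : IsPersistentlyExciting P w n) {c : Fin n × Fin m → ℂ}
    (hc : ∀ t ω, ∑ a, c a * w (t + (a.1 : ℕ)) ω a.2 = 0) : c = 0 := by
  obtain ⟨C, hC, hlim⟩ := hw
  by_contra hne
  have h1 : HasLimitExpectation P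
      (fun t ω => ∑ a, ∑ b, c a * conj (c b) *
        (w (t + (a.1 : ℕ)) ω a.2 * conj (w (t + (b.1 : ℕ)) ω b.2)))
      (∑ a, ∑ b, c a * conj (c b) * C a b) :=
    HasLimitExpectation.sum fun a _ => HasLimitExpectation.sum fun b _ => (hlim a b).const_mul _
  have h2 : ∀ t ω, ∑ a, ∑ b, c a * conj (c b) *
      (w (t + (a.1 : ℕ)) ω a.2 * conj (w (t + (b.1 : ℕ)) ω b.2)) = 0 := by
    intro t ω
    have h3 : (∑ a, c a * w (t + (a.1 : ℕ)) ω a.2) *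
        conj (∑ b, c b * w (t + (b.1 : ℕ)) ω b.2) = 0 := by rw [hc, zero_mul]
    rw [map_sum, Finset.sum_mul_sum] at h3
    rw [← h3]
    refine Finset.sum_congr rfl fun a _ => Finset.sum_congr rfl fun b _ => ?_
    rw [map_mul]
    ring
  have h3 := h1.2
  simp only [h2, integral_zero] at h3
  have h4 := tendsto_nhds_unique h3 tendsto_const_nhds
  -- The covariance is E(w_a conj w_b), so the vector to test is the conjugate of c.
  have h5 : star (star c) ⬝ᵥ (C *ᵥ star c) = ∑ a, ∑ b, c a * conj (c b) * C a b := by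
    simp only [star_star, dotProduct, Matrix.mulVec, Finset.mul_sum, Pi.star_apply]
    refine Finset.sum_congr rfl fun a _ => Finset.sum_congr rfl fun b _ => ?_
    rw [starRingEnd_apply]
    ring
  have h6 := hC.dotProduct_mulVec_pos (x := star c) (by simpa using hne)
  rw [h5, h4] at h6
  exact lt_irrefl _ h6

/-- A polynomial row that annihilates Hᵤ also annihilates the probing signal on every path, giving a
difference equation on n samples that excitation forbids. -/
lemma IsPersistentlyExciting.poly_eq_zero {Ω : Type*} [MeasurableSpace Ω] {P : Measure Ω}
    {m s n : ℕ} {Hu : Matrix (Fin m) (Fin s) (RatFunc ℂ)} (hHu : IsProper Hu)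
    {ε : ℕ → Ω → Fin s → ℂ}
    (hw : IsPersistentlyExciting P (fun t ω => applyTF Hu (fun τ => ε τ ω) t) n)
    {L : Fin m → Polynomial ℂ} (hdeg : ∀ l, (L l).natDegree < n)
    (hL : ∀ b, ∑ l, algebraMap _ (RatFunc ℂ) (L l) * Hu l b = 0) : L = 0 := by
  have hc := hw.eq_zero (c := fun a => (L a.2).coeff a.1) fun t ω => by
    have h1 : ∑ l, polyLaurent (L l) * sigv (applyTF Hu (fun τ => ε τ ω)) l = 0 := by
      rw [sigv_applyTF hHu.isCausal]
      simp only [Matrix.mulVec, dotProduct, Finset.mul_sum, Matrix.map_apply]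
      rw [Finset.sum_comm]
      refine Finset.sum_eq_zero fun b _ => ?_
      simp only [← mul_assoc, ← laurentHom_algebraMap, ← map_mul]
      rw [← Finset.sum_mul, ← map_sum, hL, map_zero, zero_mul]
    have h2 := congrArg (fun x : LaurentSeries ℂ => x.coeff (t : ℤ)) h1
    simp only [HahnSeries.coeff_sum, HahnSeries.coeff_zero, sigv,
      coeff_polyLaurent_mul_sig (hdeg _)] at h2
    rw [Fintype.sum_prod_type, Finset.sum_comm]
    exact h2
  ext l i
  rcases lt_or_ge i n with hi | hi
  · exact congrFun hc (⟨i, hi⟩, l)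
  · rw [Polynomial.coeff_eq_zero_of_natDegree_lt ((hdeg l).trans_le hi)]
    rfl

/-- The numerator of `∑ₖ cₖ / (z - μₖ)`. -/
def poleNum {q : ℕ} (μ : Fin q → ℂ) (c : Fin q → ℂ) : Polynomial ℂ :=
  ∑ k, Polynomial.C (c k) * ∏ j ∈ Finset.univ.erase k, (Polynomial.X - Polynomial.C (μ j))

/-- The bound does not involve μ, so the excitation order can be fixed before the poles are chosen.
-/
lemma natDegree_poleNum_le {q : ℕ} (μ : Fin q → ℂ) (c : Fin q → ℂ) :
    (poleNum μ c).natDegree ≤ q := by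
  refine Polynomial.natDegree_sum_le_of_forall_le _ _ fun k _ => ?_
  refine (Polynomial.natDegree_C_mul_le _ _).trans ?_
  rw [Polynomial.natDegree_finsetProd_X_sub_C_eq_card]
  exact (Finset.card_le_univ _).trans (by simp)

lemma algebraMap_poleNum {q : ℕ} (μ : Fin q → ℂ) (c : Fin q → ℂ) :
    algebraMap _ (RatFunc ℂ) (poleNum μ c) =
      (∏ j, (RatFunc.X - RatFunc.C (μ j))) *
        ∑ k, RatFunc.C (c k) * (1 / (RatFunc.X - RatFunc.C (μ k))) := by
  rw [poleNum, map_sum, Finset.mul_sum]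
  refine Finset.sum_congr rfl fun k _ => ?_
  have h0 := ratFunc_X_sub_C_ne_zero (μ k)
  rw [map_mul, map_prod, RatFunc.algebraMap_C, ← Finset.mul_prod_erase _ _ (Finset.mem_univ k)]
  simp only [map_sub, RatFunc.algebraMap_X, RatFunc.algebraMap_C]
  field_simp

/-- At μ k every summand but the k-th vanishes, and the remaining product is nonzero because the
poles are distinct. -/
lemma poleNum_eq_zero {q : ℕ} {μ : Fin q → ℂ} (hμ : Function.Injective μ) {c : Fin q → ℂ}
    (h : poleNum μ c = 0) : c = 0 := by
  ext k
  have h1 := congrArg (Polynomial.eval (μ k)) h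
  rw [poleNum, Polynomial.eval_finsetSum, Finset.sum_eq_single k] at h1
  · simp only [Polynomial.eval_mul, Polynomial.eval_C, Polynomial.eval_prod, Polynomial.eval_sub,
      Polynomial.eval_X, Polynomial.eval_zero, mul_eq_zero, Finset.prod_eq_zero_iff] at h1
    rcases h1 with h1 | ⟨j, hj, h1⟩
    · exact h1
    · exact absurd (hμ (sub_eq_zero.1 h1)).symm (Finset.ne_of_mem_erase hj)
  · intro j _ hj
    rw [Polynomial.eval_mul, Polynomial.eval_prod,
      Finset.prod_eq_zero (Finset.mem_erase.2 ⟨hj.symm, Finset.mem_univ k⟩) (by simp), mul_zero]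
  · exact fun h => absurd (Finset.mem_univ k) h

/-- A persistently exciting probing signal of high order, filtered by an invertible `T` and by
distinct poles, gives linearly independent regressors. -/
lemma exists_excitation_order {m : ℕ} (q : ℕ) {T T' : Matrix (Fin m) (Fin m) (RatFunc ℂ)}
    (hT : T * T' = 1) :
    ∃ n₀ : ℕ, ∀ {Ω : Type*} [MeasurableSpace Ω] {P : Measure Ω} {s : ℕ}
      {Hu : Matrix (Fin m) (Fin s) (RatFunc ℂ)} {ε : ℕ → Ω → Fin s → ℂ} {μ : Fin q → ℂ},
      IsProper Hu → Function.Injective μ →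
      IsPersistentlyExciting P (fun t ω => applyTF Hu (fun τ => ε τ ω) t) n₀ →
      ∀ x : Fin q × Fin m → ℂ,
        (∀ b, ∑ k, RatFunc.C (x k) * (1 / (RatFunc.X - RatFunc.C (μ k.1)) * (T * Hu) k.2 b) = 0) →
        x = 0 := by
  -- D is a common denominator of the entries of T, and M = D T is its polynomial numerator.
  obtain ⟨D, hD⟩ := IsLocalization.exist_integer_multiples (nonZeroDivisors (Polynomial ℂ))
    (Finset.univ : Finset (Fin m × Fin m)) fun a => T a.1 a.2
  have hD' : ∀ i j, ∃ M : Polynomial ℂ,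
      algebraMap _ (RatFunc ℂ) M = algebraMap _ (RatFunc ℂ) (D : Polynomial ℂ) * T i j := by
    intro i j
    obtain ⟨M, hM⟩ := hD (i, j) (Finset.mem_univ _)
    exact ⟨M, by rw [hM, Algebra.smul_def]⟩
  choose M hM using hD'
  -- q bounds the degree of the numerator of V, the supremum bounds that of D T, and a polynomial of
  -- degree d involves d + 1 samples.
  refine ⟨q + (Finset.univ : Finset (Fin m × Fin m)).sup (fun a => (M a.1 a.2).natDegree) + 1, ?_⟩
  intro Ω _ P s Hu ε μ hHu hμ hw x hx
  set π : RatFunc ℂ := ∏ j, (RatFunc.X - RatFunc.C (μ j)) with hπ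
  have hπ0 : π ≠ 0 := Finset.prod_ne_zero_iff.2 fun j _ => ratFunc_X_sub_C_ne_zero (μ j)
  have hD0 : algebraMap _ (RatFunc ℂ) (D : Polynomial ℂ) ≠ 0 :=
    RatFunc.algebraMap_ne_zero (nonZeroDivisors.ne_zero D.2)
  set V : Fin m → RatFunc ℂ := fun l =>
    ∑ k, RatFunc.C (x (k, l)) * (1 / (RatFunc.X - RatFunc.C (μ k))) with hV
  set p : Fin m → Polynomial ℂ := fun l => poleNum μ fun k => x (k, l) with hp
  have hpV : ∀ l, algebraMap _ (RatFunc ℂ) (p l) = π * V l := fun l => algebraMap_poleNum _ _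
  -- L is the row V T with the denominators π of V and D of T cleared.
  set L : Fin m → Polynomial ℂ := fun l => ∑ i, p i * M i l with hL
  have hLV : ∀ l, algebraMap _ (RatFunc ℂ) (L l) = π * algebraMap _ (RatFunc ℂ) (D : Polynomial ℂ) *
      (V ᵥ* T) l := by
    intro l
    rw [hL]
    simp only [map_sum, map_mul, hpV, hM, Matrix.vecMul, dotProduct, Finset.mul_sum]
    refine Finset.sum_congr rfl fun i _ => ?_
    ring
  have hVT : V ᵥ* (T * Hu) = 0 := by
    ext1 b
    rw [Pi.zero_apply, ← hx b, Fintype.sum_prod_type, Finset.sum_comm]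
    simp only [Matrix.vecMul, dotProduct, hV, Finset.sum_mul]
    refine Finset.sum_congr rfl fun l _ => Finset.sum_congr rfl fun k _ => ?_
    ring
  have hL0 : L = 0 := by
    refine hw.poly_eq_zero hHu (fun l => ?_) fun b => ?_
    · refine Nat.lt_succ_of_le (Polynomial.natDegree_sum_le_of_forall_le _ _ fun i _ => ?_)
      refine Polynomial.natDegree_mul_le.trans (add_le_add (natDegree_poleNum_le _ _) ?_)
      exact Finset.le_sup (f := fun a : Fin m × Fin m => (M a.1 a.2).natDegree)
        (Finset.mem_univ (i, l))
    · have h1 := congrFun hVT b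
      rw [← Matrix.vecMul_vecMul] at h1
      simp only [hLV, mul_assoc, ← Finset.mul_sum]
      simp only [Matrix.vecMul, dotProduct, Pi.zero_apply] at h1 ⊢
      rw [h1, mul_zero, mul_zero]
  have hVT0 : V ᵥ* T = 0 := by
    ext1 l
    have h1 := hLV l
    rw [hL0, Pi.zero_apply, map_zero, eq_comm] at h1
    exact (mul_eq_zero.1 h1).resolve_left (mul_ne_zero hπ0 hD0)
  have hV0 : V = 0 := by
    rw [← Matrix.vecMul_one V, ← hT, ← Matrix.vecMul_vecMul, hVT0, Matrix.zero_vecMul]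
  ext ⟨k, l⟩
  have h1 : p l = 0 := by
    refine RatFunc.algebraMap_injective ℂ ?_
    rw [hpV, hV0, Pi.zero_apply, mul_zero, map_zero]
  exact congrFun (poleNum_eq_zero hμ h1) k

end OBF

end

/-! ### Assembly of the convergence theorem. -/

noncomputable section

namespace OBF

open scoped Matrix

/-- Least squares with signals that are filtered white noises. -/
lemma leastSquares_filtered {Ω ι : Type*} [MeasurableSpace Ω] {P : Measure Ω}
    [IsProbabilityMeasure P] [Fintype ι] [DecidableEq ι] {v : ℕ → Ω → ι → ℂ} {K : ℝ}
    (hv : IsWhite P v K) {p m q : ℕ} {μ : Fin q → ℂ} (hμ : ∀ k, ‖μ k‖ < 1)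
    {y : ℕ → Ω → Fin p → ℂ} {u : ℕ → Ω → Fin m → ℂ}
    {α : Fin p → ℕ → ι → ℂ} {β : Fin q × Fin m → ℕ → ι → ℂ}
    (hα : ∀ i a, ExpDecay fun j => α i j a) (hβ : ∀ x a, ExpDecay fun j => β x j a)
    (hy : ∀ t ω i, y t ω i = filtered (α i) v t ω)
    (hu : ∀ t ω x, regressor μ (fun τ => u τ ω) t x = filtered (β x) v t ω)
    (hli : ∀ c : Fin q × Fin m → ℂ, (∀ j a, ∑ x, c x * β x j a = 0) → c = 0) :
    ∃ (J : (Fin q → Matrix (Fin p) (Fin m) ℂ) → ℝ) (Rstar : Fin q → Matrix (Fin p) (Fin m) ℂ),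
      (∀ R, HasLimitExpectation P
        (fun t ω => sqError μ (fun τ => y τ ω) (fun τ => u τ ω) R t) (J R)) ∧
      (∀ R, R ≠ Rstar → J Rstar < J R) ∧
      ∀ᵐ ω ∂P,
        (∀ᶠ N : ℕ in atTop,
          ∃! R, IsLSSolution μ (fun τ => y τ ω) (fun τ => u τ ω) N R) ∧
        ∀ RN : ℕ → Fin q → Matrix (Fin p) (Fin m) ℂ,
          (∀ᶠ N : ℕ in atTop,
            IsLSSolution μ (fun τ => y τ ω) (fun τ => u τ ω) N (RN N)) →
          ∀ δ : ℝ, 0 < δ →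
            Tendsto (fun N : ℕ => h2Norm (model μ (RN N) - model μ Rstar) /
              (N : ℝ) ^ (-(1 / 2 : ℝ) + δ)) atTop (𝓝 0) := by
  set Γ : Matrix (Fin q × Fin m) (Fin q × Fin m) ℂ :=
    Matrix.of fun k l => limCov (β l) (β k) with hΓ
  have hpd : Γ.PosDef := limCov_posDef hβ hli
  have hdet : IsUnit Γ.det := (Matrix.isUnit_iff_isUnit_det _).1 hpd.isUnit
  set b : Fin p → Fin q × Fin m → ℂ := fun i k => limCov (α i) (β k) with hb
  set θ : Fin p → Fin q × Fin m → ℂ := fun i => Γ⁻¹ *ᵥ b i with hθ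
  have hΓθ : ∀ i, Γ *ᵥ θ i = b i := by
    intro i
    rw [hθ, Matrix.mulVec_mulVec, Matrix.mul_nonsing_inv _ hdet, Matrix.one_mulVec]
  refine ⟨fun R => ∑ i, (lsQuad (limCov (α i) (α i)) (b i) Γ (rows R i)).re, rows.symm θ,
    fun R => ?_, fun R hR => ?_, ?_⟩
  · have h1 : HasLimitExpectation P (fun t ω => ∑ i, (lsQuad
        (filtered (α i) v t ω * conj (filtered (α i) v t ω))
        (fun k => filtered (α i) v t ω * conj (filtered (β k) v t ω))
        (Matrix.of fun k l => filtered (β l) v t ω * conj (filtered (β k) v t ω)) (rows R i)).re)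
        (∑ i, (lsQuad (limCov (α i) (α i)) (b i) Γ (rows R i)).re) := by
      refine HasLimitExpectation.sum fun i _ => HasLimitExpectation.re ?_
      exact HasLimitExpectation.lsQuad (hv.hasLimitExpectation_filtered (hα i) (hα i))
        (fun k => hv.hasLimitExpectation_filtered (hα i) (hβ k))
        (fun k l => hv.hasLimitExpectation_filtered (hβ l) (hβ k)) (rows R i)
    simp only [sqError_eq]
    simpa only [← norm_sub_sq_eq_lsQuad, ← hy, ← hu] using h1
  · simp only [Equiv.apply_symm_apply]
    exact sum_re_lsQuad_lt hpd hΓθ fun h => hR (rows.eq_symm_apply.2 h)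
  · have hG : ∀ᵐ ω ∂P, ∀ k l, HasRate fun N =>
        sampleGram (regressor μ fun τ => u τ ω) N k l - Γ k l := by
      simp only [ae_all_iff]
      intro k l
      filter_upwards [hv.ae_hasRate_filtered (hβ l) (hβ k)] with ω hω
      simpa only [hΓ, sampleGram, average, Matrix.of_apply, hu] using hω
    have hB : ∀ᵐ ω ∂P, ∀ i k, HasRate fun N =>
        sampleCorr (fun t => y t ω i) (regressor μ fun τ => u τ ω) N k - b i k := by
      simp only [ae_all_iff]
      intro i k
      filter_upwards [hv.ae_hasRate_filtered (hα i) (hβ k)] with ω hω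
      simpa only [sampleCorr, average, hu, hy] using hω
    obtain ⟨C, hC⟩ := exists_h2Norm_le (p := p) (m := m) hμ
    filter_upwards [hG, hB] with ω hGω hBω
    have hne := fun i => hasRate_normal_equations hdet hGω (hBω i)
    -- Zero right-hand sides are used because for p = 0 there is no row from which to extract the
    -- invertibility.
    have hev : ∀ᶠ N in atTop, IsUnit (sampleGram (regressor μ fun τ => u τ ω) N).det :=
      (hasRate_normal_equations (b := 0) (bN := 0) hdet hGω
        (fun k δ _ => by simp)).1
    refine ⟨?_, fun RN hRN δ hδ => ?_⟩
    · filter_upwards [hev] with N hN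
      refine ⟨rows.symm _, (isLSSolution_iff hN _).2 (Equiv.apply_symm_apply _ _), fun R hR => ?_⟩
      exact rows.eq_symm_apply.2 ((isLSSolution_iff hN R).1 hR)
    · have hrate : (fun N => C * ∑ i, ∑ x, ‖rows (RN N) i x - θ i x‖) =o[atTop]
          fun N : ℕ => (N : ℝ) ^ (-(1 / 2 : ℝ) + δ) := by
        refine Asymptotics.IsLittleO.const_mul_left ?_ C
        have h1 : ∀ i x, (fun N => rows (RN N) i x - θ i x) =o[atTop]
            fun N : ℕ => (N : ℝ) ^ (-(1 / 2 : ℝ) + δ) := by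
          intro i x
          refine ((hne i).2 x δ hδ).congr' ?_ EventuallyEq.rfl
          filter_upwards [hev, hRN] with N hN hR
          rw [(isLSSolution_iff hN _).1 hR]
        exact Asymptotics.IsLittleO.fun_sum fun i _ => Asymptotics.IsLittleO.fun_sum fun x _ =>
          (h1 i x).norm_left
      refine Asymptotics.IsLittleO.tendsto_div_nhds_zero (Asymptotics.IsBigO.trans_isLittleO ?_ hrate)
      refine Asymptotics.isBigO_of_le _ fun N => ?_
      have h2 := hC (RN N) (rows.symm θ)
      rw [Equiv.apply_symm_apply] at h2
      have h3 : 0 ≤ h2Norm (model μ (RN N) - model μ (rows.symm θ)) := Real.sqrt_nonneg _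
      rw [Real.norm_of_nonneg h3]
      exact h2.trans (le_abs_self _)

end OBF

end

theorem mainTheorem4 {p m : ℕ} (q : ℕ)
    (G : Matrix (Fin p) (Fin m) (RatFunc ℂ)) (Gu : Matrix (Fin m) (Fin p) (RatFunc ℂ))
    (hG : OBF.IsStable G) (hG' : OBF.IsStrictlyProper G) (hGu : OBF.IsProper Gu) :
    ∃ n₀ : ℕ, ∀ (r s : ℕ)
      (H : Matrix (Fin p) (Fin r) (RatFunc ℂ)) (Hu : Matrix (Fin m) (Fin s) (RatFunc ℂ)),
      OBF.IsStable H → OBF.IsProper H → OBF.IsProper Hu →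
      OBF.IsClosedLoopStable G H Gu Hu →
      ∀ (μ : Fin q → ℂ), Function.Injective μ → (∀ k, ‖μ k‖ < 1) →
      ∀ (Ω : Type*) [MeasurableSpace Ω] (P : Measure Ω) [IsProbabilityMeasure P]
        (e : ℕ → Ω → Fin r → ℂ) (ε : ℕ → Ω → Fin s → ℂ)
        (y : ℕ → Ω → Fin p → ℂ) (u : ℕ → Ω → Fin m → ℂ),
      OBF.IsIIDNoise P e → OBF.IsIIDNoise P ε →
      IndepFun (fun ω t => e t ω) (fun ω t => ε t ω) P →
      (∀ t ω, y t ω = OBF.applyTF G (fun τ => u τ ω) t + OBF.applyTF H (fun τ => e τ ω) t) →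
      (∀ t ω, u t ω = OBF.applyTF Gu (fun τ => y τ ω) t + OBF.applyTF Hu (fun τ => ε τ ω) t) →
      OBF.IsPersistentlyExciting P (fun t ω => OBF.applyTF Hu (fun τ => ε τ ω) t) n₀ →
      ∃ (J : (Fin q → Matrix (Fin p) (Fin m) ℂ) → ℝ) (Rstar : Fin q → Matrix (Fin p) (Fin m) ℂ),
        (∀ R, OBF.HasLimitExpectation P
          (fun t ω => OBF.sqError μ (fun τ => y τ ω) (fun τ => u τ ω) R t) (J R)) ∧
        (∀ R, R ≠ Rstar → J Rstar < J R) ∧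
        ∀ᵐ ω ∂P,
          (∀ᶠ N : ℕ in atTop,
            ∃! R, OBF.IsLSSolution μ (fun τ => y τ ω) (fun τ => u τ ω) N R) ∧
          ∀ RN : ℕ → Fin q → Matrix (Fin p) (Fin m) ℂ,
            (∀ᶠ N : ℕ in atTop,
              OBF.IsLSSolution μ (fun τ => y τ ω) (fun τ => u τ ω) N (RN N)) →
            ∀ δ : ℝ, 0 < δ →
              Tendsto (fun N : ℕ => OBF.h2Norm (OBF.model μ (RN N) - OBF.model μ Rstar) /
                (N : ℝ) ^ (-(1 / 2 : ℝ) + δ)) atTop (𝓝 0) := by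
  -- The order is fixed by T = 1 + Gᵤ (1 - G Gᵤ)⁻¹ G, hence before H, Hᵤ, the poles and the noises
  -- are introduced.
  obtain ⟨n₀, hn₀⟩ := OBF.exists_excitation_order q (OBF.one_sub_mul_inv hG' hGu)
  refine ⟨n₀, ?_⟩
  intro r s H Hu _ hH hHu hcl μ hμinj hμ Ω _ P _ e ε y u he hε hind hy hu hpe
  obtain ⟨K, hv⟩ := OBF.isWhite_joinNoise he hε hind
  obtain ⟨st₁, st₂, st₃, st₄⟩ := hcl
  have hS := (OBF.sensitivity hG' hGu).2
  set S := (1 - G * Gu)⁻¹ with hSdef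
  set Fy : Fin p → Fin r ⊕ Fin s → RatFunc ℂ := fun i =>
    Sum.elim ((S * H) i) ((S * G * Hu) i) with hFy
  set Fu : Fin m → Fin r ⊕ Fin s → RatFunc ℂ := fun i =>
    Sum.elim ((Gu * S * H) i) ((Hu + Gu * S * G * Hu) i) with hFu
  have hcy : ∀ i a, OBF.laurentHom (Fy i a) ∈ OBF.causal := by
    rintro i (a | a)
    · exact hS.mul hH.isCausal i a
    · exact (hS.mul hG'.isCausal).mul hHu.isCausal i a
  have hcu : ∀ i a, OBF.laurentHom (Fu i a) ∈ OBF.causal := by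
    rintro i (a | a)
    · exact (hGu.isCausal.mul hS).mul hH.isCausal i a
    · exact hHu.isCausal.add (((hGu.isCausal.mul hS).mul hG'.isCausal).mul hHu.isCausal) i a
  have hdy : ∀ i a, OBF.ExpDecay (OBF.impulse (Fy i a)) := by
    rintro i (a | a)
    · exact OBF.expDecay_impulse (st₁ i a)
    · exact OBF.expDecay_impulse (st₂ i a)
  have hdu : ∀ i a, OBF.ExpDecay (OBF.impulse (Fu i a)) := by
    rintro i (a | a)
    · exact OBF.expDecay_impulse (st₃ i a)
    · exact OBF.expDecay_impulse (st₄ i a)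
  have hloop := fun ω => OBF.closed_loop hG' hGu hH hHu (fun t => hy t ω) (fun t => hu t ω)
  have hsu : ∀ ω l, OBF.sigv (fun τ => u τ ω) l =
      ∑ a, OBF.laurentHom (Fu l a) * OBF.sig (fun t => OBF.joinNoise e ε t ω a) := by
    intro ω l
    rw [(hloop ω).2, hFu, OBF.sum_sumElim_mul_sig]
    rfl
  have hcφ : ∀ (x : Fin q × Fin m) a,
      OBF.laurentHom (1 / (RatFunc.X - RatFunc.C (μ x.1)) * Fu x.2 a) ∈ OBF.causal := by
    intro x a
    rw [map_mul]
    exact OBF.causal.mul_mem (OBF.pole_mem_causal _) (hcu _ _)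
  refine OBF.leastSquares_filtered hv hμ (α := fun i j a => OBF.impulse (Fy i a) j)
    (β := fun x j a => OBF.impulse (1 / (RatFunc.X - RatFunc.C (μ x.1)) * Fu x.2 a) j)
    hdy (fun x a => (hdu x.2 a).impulse_mul (hμ x.1)) (fun t ω i => ?_) (fun t ω x => ?_)
    (fun c hc => ?_)
  · refine OBF.eq_filtered (hcy i) (x := fun t => y t ω i) ?_ t
    have h := congrFun (hloop ω).1 i
    rw [hFy, OBF.sum_sumElim_mul_sig]
    exact h
  · refine OBF.eq_filtered (hcφ x) (x := fun t => OBF.regressor μ (fun τ => u τ ω) t x) ?_ t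
    rw [OBF.sig_regressor, hsu, Finset.mul_sum]
    simp only [map_mul, mul_assoc]
  -- Only the ε-columns of the vanishing combination are used, since there the input filter is T Hᵤ.
  · refine hn₀ hHu hμinj hpe c fun b => ?_
    have hFb : ∀ l, ((1 + Gu * S * G) * Hu : Matrix (Fin m) (Fin s) (RatFunc ℂ)) l b = Fu l (Sum.inr b) := by
      intro l
      rw [Matrix.add_mul, Matrix.one_mul]
      rfl
    simp only [hFb]
    refine OBF.laurentHom_injective ?_
    rw [map_zero]
    ext n
    rw [map_sum, HahnSeries.coeff_sum, HahnSeries.coeff_zero]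
    simp only [map_mul _ (RatFunc.C _), OBF.laurentHom_C, HahnSeries.C_mul_eq_smul,
      HahnSeries.coeff_smul, smul_eq_mul]
    -- The hypothesis concerns impulse responses, that is, coefficients with n ≥ 0; the others
    -- vanish by causality.
    rcases lt_or_ge n 0 with hn | hn
    · refine Finset.sum_eq_zero fun x _ => ?_
      rw [OBF.mem_causal_iff.1 (hcφ x _) n hn, mul_zero]
    · lift n to ℕ using hn
      simpa only [OBF.impulse_eq] using hc n (Sum.inr b)
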